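/- Digraphs are finite and may have loops and parallel edges. A digraph is $2$-regular if every vertex has indegree two and outdegree two, and it is strongly $2$-edge-connected if $H-F$ is strongly connected for every set $F$ of fewer than two edges. An embedding of a $2$-regular digraph $H$ in the sphere $S^2$ maps the vertices injectively to points of $S^2$ and each edge to a simple curve (closed, for a loop) from the image of its tail to the image of its head, so that these curves are internally disjoint from each other and from the vertices, and so that every face (connected component of the complement of the image of $H$) is an open disc bounded by a directed closed walk of $H$. That a directed closed walk $e_1e_2\cdots e_k$ ($k\ge 1$) bounds the face $F$ means that there is a continuous map from the closed unit disc to $S^2$ which maps the open disc homeomorphically onto $F$ and which runs along the curves of $e_1,\dots,e_k$ in turn on the unit circle. The directed closed walks that bound a face, considered up to cyclic rotation, are the facial walks of the embedding. Two embeddings are equivalent if they have the same set of facial walks. Theorem. Any two embeddings in $S^2$ of a strongly $2$-edge-connected $2$-regular digraph are equivalent. -/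

import Mathlib

/-- A directed multigraph with vertex set `V` and edge set `E`; parallel edges and loops
are allowed. -/
structure MultiDigraph (V : Type*) (E : Type*) where
  /-- The vertex from which an edge is directed away. -/
  tail : E → V
  /-- The vertex towards which an edge is directed. -/
  head : E → V

namespace MultiDigraph

/-- Every vertex has outdegree two and indegree two. -/
def IsTwoRegular {V E : Type*} (H : MultiDigraph V E) : Prop :=
  ∀ v : V, {e : E | H.tail e = v}.ncard = 2 ∧ {e : E | H.head e = v}.ncard = 2

/-- There is a directed walk from `u` to `v` in the digraph `H - F`, obtained from `H` by
deleting the edges in `F` and keeping all vertices. -/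
def ReachableAvoiding {V E : Type*} (H : MultiDigraph V E) (F : Finset E) (u v : V) : Prop :=
  Relation.ReflTransGen (fun x y => ∃ e : E, e ∉ F ∧ H.tail e = x ∧ H.head e = y) u v

/-- `H` is strongly `k`-edge-connected: `H - F` is strongly connected for every set `F` of
fewer than `k` edges. -/
def IsStronglyEdgeConnected {V E : Type*} (H : MultiDigraph V E) (k : ℕ) : Prop :=
  ∀ F : Finset E, F.card < k → ∀ u v : V, H.ReachableAvoiding F u v

/-- The nonempty list of edges `w` is a directed closed walk: the head of each edge is the tail
of the cyclically next one. -/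
def IsClosedDiwalk {V E : Type*} (H : MultiDigraph V E) (w : List E) : Prop :=
  ∃ hw : 0 < w.length, ∀ j : Fin w.length,
    H.head (w.get j) = H.tail (w.get ⟨(j.val + 1) % w.length, Nat.mod_lt _ hw⟩)

/-- An embedding of the underlying graph of `H` in the space `S`: vertices go to distinct
points, each edge goes to a simple curve joining the images of its ends (a simple closed curve
for a loop), and these curves are internally disjoint from each other and from the vertices.
The curve of an edge is parametrized from its tail to its head. -/
structure GraphEmbedding {V E : Type*} (H : MultiDigraph V E)
    (S : Type*) [TopologicalSpace S] where
  /-- The image of a vertex. -/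
  vert : V → S
  vert_injective : Function.Injective vert
  /-- The curve assigned to an edge. -/
  edge : (e : E) → Path (vert (H.tail e)) (vert (H.head e))
  edge_interior_injective : ∀ (e e' : E) (s t : unitInterval),
    s ∈ Set.Ioo (0 : unitInterval) 1 → t ∈ Set.Ioo (0 : unitInterval) 1 →
      edge e s = edge e' t → e = e' ∧ s = t
  edge_interior_ne_vert : ∀ (e : E) (s : unitInterval) (v : V),
    s ∈ Set.Ioo (0 : unitInterval) 1 → edge e s ≠ vert v

namespace GraphEmbedding

/-- The image of the graph: all vertex points and all edge curves. -/
def carrier {V E : Type*} {H : MultiDigraph V E} {S : Type*} [TopologicalSpace S]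
    (φ : H.GraphEmbedding S) : Set S :=
  Set.range φ.vert ∪ ⋃ e : E, Set.range (φ.edge e)

/-- The faces are the connected components of the complement of the image of the graph. -/
def IsFace {V E : Type*} {H : MultiDigraph V E} {S : Type*} [TopologicalSpace S]
    (φ : H.GraphEmbedding S) (F : Set S) : Prop :=
  ∃ x ∈ (φ.carrier)ᶜ, F = connectedComponentIn (φ.carrier)ᶜ x

/-- The set `F` is an open disc bounded by the directed closed walk `w`: there is a continuous
map of the closed unit disc that takes the open disc homeomorphically onto `F` and whose
restriction to the unit circle, divided into `w.length` equal arcs, runs through the curves of the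
successive edges of `w`. -/
def BoundedBy {V E : Type*} {H : MultiDigraph V E} {S : Type*} [TopologicalSpace S]
    (φ : H.GraphEmbedding S) (F : Set S) (w : List E) : Prop :=
  H.IsClosedDiwalk w ∧
  ∃ Φ : ℂ → S,
    ContinuousOn Φ (Metric.closedBall 0 1) ∧
    Topology.IsEmbedding ((Metric.ball (0 : ℂ) 1).domRestrict Φ) ∧
    Φ '' Metric.ball 0 1 = F ∧
    ∀ (j : Fin w.length) (t : unitInterval),
      Φ (Complex.exp (2 * Real.pi * Complex.I *
        (((j.val : ℂ) + ((t : ℝ) : ℂ)) / (w.length : ℂ)))) = φ.edge (w.get j) t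

end GraphEmbedding

/-- An embedding of the digraph `H` in `S`: a 2-cell embedding of the underlying graph in
which every face is bounded by a directed closed walk. (That the faces are open discs is part
of `GraphEmbedding.BoundedBy`.) -/
structure Embedding {V E : Type*} (H : MultiDigraph V E) (S : Type*) [TopologicalSpace S]
    extends H.GraphEmbedding S where
  face_bounded : ∀ F : Set S, toGraphEmbedding.IsFace F →
    ∃ w : List E, toGraphEmbedding.BoundedBy F w

namespace Embedding

/-- The facial walks of an embedding, as cyclic sequences of edges (lists up to rotation), each
traversed in the direction of its edges. -/
def facialWalks {V E : Type*} {H : MultiDigraph V E} {S : Type*} [TopologicalSpace S]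
    (φ : H.Embedding S) : Set (Cycle E) :=
  {c | ∃ (F : Set S) (w : List E), φ.IsFace F ∧ φ.BoundedBy F w ∧ c = (w : Cycle E)}

/-- Two embeddings, possibly in different surfaces, are equivalent if they have the same facial
walks. -/
def Equivalent {V E : Type*} {H : MultiDigraph V E} {S₁ S₂ : Type*} [TopologicalSpace S₁]
    [TopologicalSpace S₂] (φ₁ : H.Embedding S₁) (φ₂ : H.Embedding S₂) : Prop :=
  φ₁.facialWalks = φ₂.facialWalks

end Embedding

end MultiDigraph

/-!
The proof extracts from an embedding in the sphere a few combinatorial properties of its facial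
walks, and then compares two systems of walks that have these properties.

*Topology.* Two facts about continuous logarithms are used: a map without zeros on a plane has one,
and for a compact set `K` in the plane the existence of a logarithm of `z - a` on `K` depends only
on the component of `a` in the complement of `K`.

The sphere without one point is a plane. Given an integer `c e` for every edge `e`, there is a map
from the graph to the punctured plane that winds `c e` times around `0` along `e`. If the sum of `c`
vanishes along the boundaries of all faces but one, this map extends to the sphere without a point
of the exceptional face, and therefore has a logarithm there, so `c` is the difference of a
potential on the vertices (`exists_potential`). Applied to the indicator function of an edge, this
shows that every edge lies on at least two faces, as the digraph without the edge is strongly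
connected. Conversely, let `e` lie on two faces. In the plane obtained by removing the centre of one
of them, the centre `a` of the other can be joined to infinity across `e`, so `z - a` has a
logarithm on the graph without `e`, and a closed walk winds around `a` a fixed number of times for
every passage through `e`. As the boundary of the face of `a` winds around `a` exactly once, it
passes `e` once, and a third face does not pass `e` at all (`FaceDisc.count_eq_one_and_notMem`).
Finally, the sphere without the vertices is connected, so the faces are connected through edges
(`eq_univ_of_closed`). These properties are collected in `IsFaceSystem`.

*Combinatorics.* The faces can be coloured with two colours so that each edge lies on one face of
either colour: an odd closed sequence of adjacent faces would give, by alternating signs, a function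
on the edges whose sum is nonzero along exactly one face (`IsFaceSystem.exists_colouring`). So an
embedding is described by two permutations of the edges, one for each colour, mapping an edge to
the next edge on its face (`Tracing`). Two faces of different colours share at most one edge, for
otherwise the difference of the indicator functions of two shared edges is a difference of
potentials, and this gives a directed cut with a single edge (`Tracing.eq_of_face_eq`). In
particular, the two permutations differ at every vertex, so that a second embedding has, at every
vertex, either the same two permutations or the same two permutations exchanged. Let `X` be the set
of vertices of the first kind, and let `C` be a face of the first embedding of the second colour.
The edges of `C` that enter or leave `X`, counted with signs, have sum zero along all faces of the
second embedding, because such a face follows `C` either inside `X` or outside `X`. Hence they have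
sum zero along every closed walk, in particular along every face of the first embedding of the first
colour, which has at most one edge in common with `C`. So no edge of `C` enters or leaves `X`. This
holds for all `C`, so `X` is empty or contains all vertices (`Tracing.next_eq_or_eq_swap`).
-/

/-! ### Continuous logarithms -/

open Complex in
/-- A nowhere vanishing continuous function on a simply connected space has a continuous
logarithm. -/
theorem exists_continuous_log {A : Type*} [TopologicalSpace A] [SimplyConnectedSpace A]
    [LocallyPathConnectedSpace A] {f : A → ℂ} (hf : Continuous f) (h0 : ∀ a, f a ≠ 0) :
    ∃ L : A → ℂ, Continuous L ∧ ∀ a, exp (L a) = f a := by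
  obtain ⟨a₀⟩ : Nonempty A := inferInstance
  obtain ⟨F, ⟨-, hF⟩, -⟩ := isCoveringMapOn_exp.existsUnique_continuousMap_lifts ⟨f, hf⟩
    (a₀ := a₀) (e₀ := log (f a₀)) (exp_log (h0 a₀)) (fun a => h0 a)
  exact ⟨F, F.continuous, fun a => congrFun hF a⟩

/-- Two continuous functions on a preconnected space with the same exponential differ by a
constant. -/
theorem sub_eq_sub_of_exp_eq {A : Type*} [TopologicalSpace A] [PreconnectedSpace A]
    {L M : A → ℂ} (hL : Continuous L) (hM : Continuous M)
    (h : ∀ a, Complex.exp (L a) = Complex.exp (M a)) (a b : A) : L a - L b = M a - M b := by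
  choose k hk using fun a => Complex.exp_eq_exp_iff_exists_int.1 (h a)
  have hk' : ∀ a, (k a : ℂ) = (L a - M a) / (2 * Real.pi * Complex.I) := fun a => by
    rw [hk a]; field_simp [Complex.two_pi_I_ne_zero]; ring
  have hc : Continuous fun a => (k a : ℂ) := by
    simp_rw [hk']; fun_prop
  have hc' : Continuous k :=
    Int.isClosedEmbedding_coe_real.isEmbedding.continuous_iff.2
      ((Complex.continuous_re.comp hc).congr fun a => by simp)
  have : k a = k b := PreconnectedSpace.constant inferInstance hc'
  rw [hk a, hk b, this]; ring

/-- The curve `γ` has a continuous logarithm whose value changes by `δ` along the curve. -/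
def HasLogIncrement (γ : unitInterval → ℂ) (δ : ℂ) : Prop :=
  ∃ m : unitInterval → ℂ, Continuous m ∧ (∀ t, Complex.exp (m t) = γ t) ∧ m 1 - m 0 = δ

theorem HasLogIncrement.unique {γ : unitInterval → ℂ} {δ δ' : ℂ} (h : HasLogIncrement γ δ)
    (h' : HasLogIncrement γ δ') : δ = δ' := by
  obtain ⟨m, hm, hγ, rfl⟩ := h
  obtain ⟨m', hm', hγ', rfl⟩ := h'
  exact sub_eq_sub_of_exp_eq hm hm' (fun a => by rw [hγ, hγ']) 1 0

/-- The radial retraction of the plane onto the closed unit disc. -/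
noncomputable def discRetract (z : ℂ) : ℂ := ((max 1 ‖z‖)⁻¹ : ℝ) * z

theorem continuous_discRetract : Continuous discRetract := by
  unfold discRetract
  have : Continuous fun z : ℂ => (max 1 ‖z‖)⁻¹ :=
    (continuous_const.max continuous_norm).inv₀ fun z => by positivity
  fun_prop

theorem discRetract_mem (z : ℂ) : discRetract z ∈ Metric.closedBall (0 : ℂ) 1 := by
  have : 0 < max 1 ‖z‖ := by positivity
  rw [mem_closedBall_zero_iff, discRetract, norm_mul, Complex.norm_real, Real.norm_eq_abs,
    abs_of_pos (by positivity), inv_mul_le_iff₀ this, mul_one]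
  exact le_max_right _ _

theorem discRetract_of_mem {z : ℂ} (hz : z ∈ Metric.closedBall (0 : ℂ) 1) :
    discRetract z = z := by
  rw [mem_closedBall_zero_iff] at hz
  simp [discRetract, max_eq_left hz]

theorem discRetract_ne_zero {z : ℂ} (hz : z ≠ 0) : discRetract z ≠ 0 := by
  have : 0 < max 1 ‖z‖ := by positivity
  simp only [discRetract, ne_eq, mul_eq_zero, hz, or_false]
  exact_mod_cast (inv_pos.2 this).ne'

theorem exists_continuous_log_closedBall {G : ℂ → ℂ}
    (hG : ContinuousOn G (Metric.closedBall 0 1))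
    (h0 : ∀ z ∈ Metric.closedBall (0 : ℂ) 1, G z ≠ 0) :
    ∃ ℓ : ℂ → ℂ, Continuous ℓ ∧ ∀ z ∈ Metric.closedBall (0 : ℂ) 1, Complex.exp (ℓ z) = G z := by
  obtain ⟨ℓ, hℓ, h⟩ := exists_continuous_log
    (hG.comp_continuous continuous_discRetract discRetract_mem)
    (fun z => h0 _ (discRetract_mem z))
  exact ⟨ℓ, hℓ, fun z hz => by rw [h, Function.comp, discRetract_of_mem hz]⟩

/-- The point of the unit circle at the angle of `θ` full turns. -/
noncomputable def turn (θ : ℝ) : ℂ := Complex.exp (2 * Real.pi * Complex.I * θ)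

theorem continuous_turn : Continuous turn := by unfold turn; fun_prop

theorem norm_turn (θ : ℝ) : ‖turn θ‖ = 1 := by
  rw [turn, Complex.norm_exp]; simp

theorem turn_mem_closedBall (θ : ℝ) : turn θ ∈ Metric.closedBall (0 : ℂ) 1 := by
  simp [norm_turn]

theorem turn_zero : turn 0 = 1 := by simp [turn]

theorem turn_one : turn 1 = 1 := by simp [turn, Complex.exp_two_pi_mul_I]

/-- A continuous function on the closed unit disc whose only zero is the centre, and which has a
continuous right inverse on a small circle around `0`, winds exactly once around `0`, in one of the
two directions. The composite of lifts of the function and of the right inverse has increment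
`2πi`, and it is also an integral multiple of the increment of the function. -/
theorem exists_log_turn_of_rightInverse {G : ℂ → ℂ}
    (hG : ContinuousOn G (Metric.closedBall 0 1))
    (h0 : ∀ z ∈ Metric.closedBall (0 : ℂ) 1, z ≠ 0 → G z ≠ 0)
    {r : ℝ} (hr : 0 < r) {N : ℂ → ℂ} (hN : ContinuousOn N (Metric.sphere 0 r))
    (hNG : ∀ u ∈ Metric.sphere (0 : ℂ) r, N u ∈ Metric.closedBall 0 1 ∧ N u ≠ 0 ∧ G (N u) = u) :
    ∃ L : ℝ → ℂ, Continuous L ∧ (∀ θ, Complex.exp (L θ) = G (turn θ)) ∧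
      (L 1 - L 0 = 2 * Real.pi * Complex.I ∨ L 1 - L 0 = -(2 * Real.pi * Complex.I)) := by
  have hpi := Complex.two_pi_I_ne_zero
  obtain ⟨H, hH, hHexp⟩ := exists_continuous_log
    (f := fun ζ : ℂ => G (discRetract (Complex.exp ζ)))
    (hG.comp_continuous (continuous_discRetract.comp Complex.continuous_exp)
      (fun ζ => discRetract_mem _))
    (fun ζ => h0 _ (discRetract_mem _) (discRetract_ne_zero (Complex.exp_ne_zero _)))
  -- `H` changes by a constant multiple `d` of `2πi` under translation by `2πi`.
  obtain ⟨d, hd⟩ : ∃ d : ℤ, ∀ ζ, H (ζ + 2 * Real.pi * Complex.I) =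
      H ζ + d * (2 * Real.pi * Complex.I) := by
    have hper : ∀ ζ, Complex.exp (H (ζ + 2 * Real.pi * Complex.I)) = Complex.exp (H ζ) :=
      fun ζ => by rw [hHexp, hHexp, Complex.exp_add, Complex.exp_two_pi_mul_I, mul_one]
    obtain ⟨d, hd⟩ := Complex.exp_eq_exp_iff_exists_int.1 (hper 0)
    refine ⟨d, fun ζ => ?_⟩
    have := sub_eq_sub_of_exp_eq (L := fun ζ => H (ζ + 2 * Real.pi * Complex.I)) (M := H)
      (by fun_prop) hH hper ζ 0
    linear_combination this + hd
  have hdn : ∀ (n : ℕ) ζ, H (ζ + n * (2 * Real.pi * Complex.I)) =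
      H ζ + n * d * (2 * Real.pi * Complex.I) := by
    intro n
    induction n with
    | zero => simp
    | succ n ih =>
      intro ζ
      have := hd (ζ + n * (2 * Real.pi * Complex.I))
      rw [ih, add_assoc] at this
      push_cast
      rw [show ((n : ℂ) + 1) * (2 * Real.pi * Complex.I) =
        n * (2 * Real.pi * Complex.I) + 2 * Real.pi * Complex.I by ring, this]
      ring
  have hdz : ∀ (n : ℤ) ζ, H (ζ + n * (2 * Real.pi * Complex.I)) =
      H ζ + n * d * (2 * Real.pi * Complex.I) := by
    intro n ζ
    obtain ⟨m, rfl | rfl⟩ := n.eq_nat_or_neg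
    · exact_mod_cast hdn m ζ
    · have := hdn m (ζ + ((-m : ℤ) : ℂ) * (2 * Real.pi * Complex.I))
      push_cast at this ⊢
      rw [show ζ + -(m : ℂ) * (2 * Real.pi * Complex.I) + m * (2 * Real.pi * Complex.I) = ζ by
        ring] at this
      linear_combination -this
  have hcirc : ∀ θ : ℝ, (r : ℂ) * turn θ ∈ Metric.sphere (0 : ℂ) r := fun θ => by
    simp [norm_turn, abs_of_pos hr]
  obtain ⟨M, hM, hMexp⟩ := exists_continuous_log (f := fun θ : ℝ => N (r * turn θ))
    (hN.comp_continuous (continuous_const.mul continuous_turn) hcirc)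
    (fun θ => (hNG _ (hcirc θ)).2.1)
  obtain ⟨n, hn⟩ : ∃ n : ℤ, M 1 = M 0 + n * (2 * Real.pi * Complex.I) :=
    Complex.exp_eq_exp_iff_exists_int.1 (by rw [hMexp, hMexp, turn_zero, turn_one])
  have hHM : ∀ θ, Complex.exp (H (M θ)) =
      Complex.exp (2 * Real.pi * Complex.I * θ + Real.log r) := by
    intro θ
    rw [hHexp, hMexp, discRetract_of_mem (hNG _ (hcirc θ)).1, (hNG _ (hcirc θ)).2.2,
      Complex.exp_add, ← Complex.ofReal_exp, Real.exp_log hr, mul_comm, turn]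
  have h1 := sub_eq_sub_of_exp_eq (hH.comp hM)
    (M := fun θ : ℝ => 2 * Real.pi * Complex.I * θ + Real.log r) (by fun_prop) hHM 1 0
  simp only [Function.comp, hn, hdz] at h1
  have hnd : n * d = 1 := by
    have : ((n * d : ℤ) : ℂ) * (2 * Real.pi * Complex.I) = 1 * (2 * Real.pi * Complex.I) := by
      push_cast at h1 ⊢
      linear_combination h1
    exact_mod_cast mul_right_cancel₀ hpi this
  refine ⟨fun θ => H (2 * Real.pi * Complex.I * θ), by fun_prop, fun θ => ?_, ?_⟩
  · rw [hHexp, ← turn, discRetract_of_mem (turn_mem_closedBall θ)]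
  · have h2 := hd 0
    simp only [Complex.ofReal_one, mul_one, Complex.ofReal_zero, mul_zero]
    rw [zero_add] at h2
    rw [h2]
    rcases Int.eq_one_or_neg_one_of_mul_eq_one (by rw [mul_comm]; exact hnd : d * n = 1)
      with h | h <;> simp [h]

/-- On the set `K`, the function `f` has a continuous logarithm. -/
def HasLogOn {S : Type*} [TopologicalSpace S] (f : S → ℂ) (K : Set S) : Prop :=
  ∃ ℓ : S → ℂ, ContinuousOn ℓ K ∧ ∀ x ∈ K, Complex.exp (ℓ x) = f x

theorem hasLogOn_sub_of_norm_lt {S : Type*} [TopologicalSpace S] {ψ : S → ℂ} {K : Set S}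
    (hψ : ContinuousOn ψ K) {B : ℂ} (hB : ∀ x ∈ K, ‖ψ x‖ < ‖B‖) :
    HasLogOn (fun x => ψ x - B) K := by
  refine ⟨fun x => Complex.log (1 + -(ψ x / B)) + Complex.log (-B), ?_, fun x hx => ?_⟩
  · refine ContinuousOn.add (ContinuousOn.clog (by fun_prop) fun x hx => ?_) continuousOn_const
    apply Complex.mem_slitPlane_of_norm_lt_one
    rw [norm_neg, norm_div, div_lt_one (lt_of_le_of_lt (norm_nonneg _) (hB x hx))]
    exact hB x hx
  · have hB0 : B ≠ 0 := norm_pos_iff.1 (lt_of_le_of_lt (norm_nonneg _) (hB x hx))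
    have h1 : 1 + -(ψ x / B) ≠ 0 := by
      intro h
      have : ψ x = B := by
        field_simp at h
        linear_combination -h
      exact absurd (hB x hx) (by simp [this])
    rw [Complex.exp_add, Complex.exp_log h1, Complex.exp_log (neg_ne_zero.2 hB0)]
    field_simp
    ring

/-- Whether `ψ - A` has a continuous logarithm on `K` depends only on the path component of `A` in
the complement of `ψ '' K`. -/
theorem HasLogOn.of_joinedIn {S : Type*} [TopologicalSpace S] {ψ : S → ℂ} {K : Set S}
    (hψ : ContinuousOn ψ K) {A B : ℂ} (h : JoinedIn (ψ '' K)ᶜ B A)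
    (hB : HasLogOn (fun x => ψ x - B) K) : HasLogOn (fun x => ψ x - A) K := by
  classical
  obtain ⟨γ, hγ⟩ := h
  obtain ⟨ℓ, hℓ, hexp⟩ := hB
  have hne : ∀ (t : unitInterval) (x : K), ψ x - γ t ≠ 0 := fun t x h0 =>
    hγ t ⟨x, x.2, by linear_combination h0⟩
  have hψ' : Continuous fun x : K => ψ x := hψ.domRestrict
  have hℓ' : Continuous fun x : K => ℓ x := hℓ.domRestrict
  let H : C(unitInterval × K, {z : ℂ // z ≠ 0}) :=
    ⟨fun p => ⟨ψ p.2 - γ p.1, hne _ _⟩, Continuous.subtype_mk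
      ((hψ'.comp continuous_snd).sub (γ.continuous.comp continuous_fst)) _⟩
  have H0 : ∀ x : K, H (0, x) = ⟨Complex.exp (ℓ x), Complex.exp_ne_zero _⟩ := fun x => by
    apply Subtype.ext
    simp [H, hexp x x.2]
  let F := Complex.isCoveringMap_exp.liftHomotopy H ⟨fun x => ℓ x, hℓ'⟩ H0
  have hF : ∀ x : K, Complex.exp (F (1, x)) = ψ x - A := fun x => by
    have := congrFun (Complex.isCoveringMap_exp.liftHomotopy_lifts H ⟨fun x => ℓ x, hℓ'⟩ H0) (1, x)
    have h1 : Complex.exp (F (1, x)) = ψ x - γ 1 := congrArg Subtype.val this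
    rw [h1, γ.target]
  refine ⟨fun x => if hx : x ∈ K then F (1, ⟨x, hx⟩) else 0, ?_, fun x hx => ?_⟩
  · rw [continuousOn_iff_continuous_domRestrict]
    have : Continuous fun x : K => F (1, x) := by fun_prop
    exact this.congr fun x => by simp
  · simp only [hx, dif_pos]
    exact hF ⟨x, hx⟩

/-! ### The sphere with one point removed -/

/-- A homeomorphism of the complement of the point `b` with the plane. The value of the chart at
`b` itself is arbitrary. -/
structure PlaneChart (S : Type*) [TopologicalSpace S] (b : S) where
  /-- The chart. -/
  toFun : S → ℂ
  /-- The inverse of the chart. -/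
  inv : ℂ → S
  continuousOn_toFun : ContinuousOn toFun {b}ᶜ
  continuous_inv : Continuous inv
  inv_ne : ∀ z, inv z ≠ b
  left_inv : ∀ x, x ≠ b → inv (toFun x) = x
  right_inv : ∀ z, toFun (inv z) = z

/-- The properties of the sphere that are used: it is a compact Hausdorff locally connected space
that becomes a plane when any one of its points is removed. -/
class SphereLike (S : Type*) [TopologicalSpace S] : Prop where
  compactSpace : CompactSpace S
  t2Space : T2Space S
  locallyConnectedSpace : LocallyConnectedSpace S
  nonempty_planeChart : ∀ b : S, Nonempty (PlaneChart S b)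

attribute [instance] SphereLike.compactSpace SphereLike.t2Space SphereLike.locallyConnectedSpace

theorem nonempty_planeChart_sphere (b : Metric.sphere (0 : EuclideanSpace ℝ (Fin 3)) 1) :
    Nonempty (PlaneChart (Metric.sphere (0 : EuclideanSpace ℝ (Fin 3)) 1) b) := by
  have : Fact (Module.finrank ℝ (EuclideanSpace ℝ (Fin 3)) = 2 + 1) := ⟨by simp⟩
  let Q := stereographic' 2 b
  have hs : Q.source = {b}ᶜ := stereographic'_source b
  have ht : Q.target = Set.univ := stereographic'_target b
  let T : EuclideanSpace ℝ (Fin 2) ≃L[ℝ] ℂ := ContinuousLinearEquiv.ofFinrankEq (by simp)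
  refine ⟨⟨fun x => T (Q x), fun z => Q.symm (T.symm z), ?_, ?_, fun z => ?_, fun x hx => ?_,
    fun z => ?_⟩⟩
  · exact T.continuous.comp_continuousOn (hs ▸ Q.continuousOn)
  · have := Q.continuousOn_symm
    rw [ht] at this
    exact (continuousOn_univ.1 this).comp T.symm.continuous
  · have : Q.symm (T.symm z) ∈ Q.source := Q.map_target (by simp [ht])
    rw [hs] at this
    exact this
  · simp only [ContinuousLinearEquiv.symm_apply_apply]
    exact Q.left_inv (by rw [hs]; exact hx)
  · rw [Q.right_inv (by simp [ht]), ContinuousLinearEquiv.apply_symm_apply]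

instance sphereLike_sphere : SphereLike (Metric.sphere (0 : EuclideanSpace ℝ (Fin 3)) 1) where
  compactSpace := inferInstance
  t2Space := inferInstance
  locallyConnectedSpace := by
    have : Fact (Module.finrank ℝ (EuclideanSpace ℝ (Fin 3)) = 2 + 1) := ⟨by simp⟩
    exact ChartedSpace.locallyConnectedSpace (EuclideanSpace ℝ (Fin 2)) _
  nonempty_planeChart := nonempty_planeChart_sphere

section

variable {S : Type*} [TopologicalSpace S]

theorem PlaneChart.injOn {b : S} (κ : PlaneChart S b) : Set.InjOn κ.toFun {b}ᶜ :=
  fun x hx y hy h => by rw [← κ.left_inv x hx, h, κ.left_inv y hy]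

/-- The complement of a nonempty finite set is connected. -/
theorem isPreconnected_compl_finite [SphereLike S] {A : Set S} (hA : A.Finite)
    (hne : A.Nonempty) : IsPreconnected Aᶜ := by
  obtain ⟨b, hb⟩ := hne
  obtain ⟨κ⟩ := SphereLike.nonempty_planeChart b
  have h : IsPreconnected (κ.toFun '' (A \ {b}))ᶜ :=
    (((hA.sdiff).image _).countable.isConnected_compl_of_one_lt_rank (by simp)).isPreconnected
  convert h.image κ.inv κ.continuous_inv.continuousOn
  ext x
  constructor
  · intro hx
    have hxb : x ≠ b := fun h => hx (h ▸ hb)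
    refine ⟨κ.toFun x, ?_, κ.left_inv x hxb⟩
    rintro ⟨y, hy, hyx⟩
    exact hx (κ.injOn hy.2 hxb hyx ▸ hy.1)
  · rintro ⟨z, hz, rfl⟩ hA
    exact hz ⟨κ.inv z, ⟨hA, κ.inv_ne z⟩, κ.right_inv z⟩

/-- A continuous function without zeros on the complement of a point has a continuous logarithm. -/
theorem hasLogOn_compl_singleton [SphereLike S] {f : S → ℂ} {b : S}
    (hf : ContinuousOn f {b}ᶜ) (h0 : ∀ x, x ≠ b → f x ≠ 0) : HasLogOn f {b}ᶜ := by
  obtain ⟨κ⟩ := SphereLike.nonempty_planeChart b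
  obtain ⟨ℓ, hℓ, hexp⟩ := exists_continuous_log (f := fun z => f (κ.inv z))
    (hf.comp_continuous κ.continuous_inv κ.inv_ne) (fun z => h0 _ (κ.inv_ne z))
  exact ⟨fun x => ℓ (κ.toFun x), hℓ.comp_continuousOn κ.continuousOn_toFun,
    fun x hx => by rw [hexp, κ.left_inv x hx]⟩

/-- Continuity of `f ∘ g`, with `g` a map of a compact set, gives continuity of `f` on the image
of `g`. -/
theorem continuousOn_image_of_comp {X Y Z : Type*} [TopologicalSpace X] [TopologicalSpace Y]
    [T2Space Y] [TopologicalSpace Z] {K : Set X} (hK : IsCompact K) {g : X → Y}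
    (hg : ContinuousOn g K) {f : Y → Z} (hf : ContinuousOn (f ∘ g) K) :
    ContinuousOn f (g '' K) := by
  rw [continuousOn_iff_isClosed]
  intro t ht
  obtain ⟨u, hu, hut⟩ := (continuousOn_iff_isClosed.1 hf) t ht
  refine ⟨g '' (u ∩ K), ?_, ?_⟩
  · exact ((hK.inter_left hu).image_of_continuousOn
      (hg.mono Set.inter_subset_right)).isClosed
  · rw [← hut]
    ext y
    constructor
    · rintro ⟨hy, x, hx, rfl⟩
      exact ⟨⟨x, ⟨hy, hx⟩, rfl⟩, ⟨x, hx, rfl⟩⟩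
    · rintro ⟨⟨x, ⟨hx, hxK⟩, rfl⟩, hy⟩
      exact ⟨hx, hy⟩

end

/-! ### Discs bounding the faces -/

theorem turn_add_int (θ : ℝ) (n : ℤ) : turn (θ + n) = turn θ := by
  rw [turn, turn, Complex.exp_eq_exp_iff_exists_int]
  exact ⟨n, by push_cast; ring⟩

/-- When the unit circle is divided into `n` equal arcs, every point of it lies on one of them. -/
theorem exists_turn_eq {z : ℂ} (hz : ‖z‖ = 1) {n : ℕ} (hn : 0 < n) :
    ∃ (j : Fin n) (t : unitInterval), turn ((j + t) / n) = z := by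
  have hn' : (0 : ℝ) < n := by exact_mod_cast hn
  set θ := Int.fract (z.arg / (2 * Real.pi)) with hθ
  have hz' : turn θ = z := by
    rw [hθ, Int.fract, sub_eq_add_neg, ← Int.cast_neg, turn_add_int, turn]
    have := Complex.norm_mul_exp_arg_mul_I z
    rw [hz, Complex.ofReal_one, one_mul] at this
    have hpi : (Real.pi : ℂ) ≠ 0 := by exact_mod_cast Real.pi_ne_zero
    rw [show 2 * Real.pi * Complex.I * ((z.arg / (2 * Real.pi) : ℝ) : ℂ) = z.arg * Complex.I by
      push_cast; field_simp, this]
  have h0 : 0 ≤ θ * n := mul_nonneg (Int.fract_nonneg _) hn'.le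
  have h1 : θ * n < n := by
    have := Int.fract_lt_one (z.arg / (2 * Real.pi))
    nlinarith
  refine ⟨⟨⌊θ * n⌋₊, (Nat.floor_lt h0).2 h1⟩, ⟨θ * n - ⌊θ * n⌋₊, ?_, ?_⟩, ?_⟩
  · linarith [Nat.floor_le h0]
  · linarith [Nat.lt_floor_add_one (θ * n)]
  · rw [← hz']
    congr 1
    field_simp
    ring

namespace MultiDigraph

/-- Along a closed directed walk, the changes of a potential add up to zero. -/
theorem IsClosedDiwalk.sum_sub_eq_zero {V E : Type*} {H : MultiDigraph V E} {w : List E}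
    (hw : H.IsClosedDiwalk w) {A : Type*} [AddCommGroup A] (g : V → A) :
    (w.map fun e => g (H.head e) - g (H.tail e)).sum = 0 := by
  obtain ⟨hpos, h⟩ := hw
  have : NeZero w.length := ⟨hpos.ne'⟩
  have hsum : ∀ f : E → A, (w.map f).sum = ∑ j : Fin w.length, f (w.get j) := fun f => by
    conv_lhs => rw [← List.ofFn_get w, List.map_ofFn, List.sum_ofFn]
    rfl
  rw [hsum, Finset.sum_sub_distrib, sub_eq_zero]
  refine Fintype.sum_equiv (Equiv.addRight 1) _ _ fun j => ?_
  rw [h j]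
  congr 3
  apply Fin.ext
  simp [Fin.val_add]

namespace GraphEmbedding

variable {V E : Type*} {H : MultiDigraph V E} {S : Type*} [TopologicalSpace S]

/-- A parametrization of the set `F` as a disc bounded by a directed closed walk. -/
structure FaceDisc (φ : H.GraphEmbedding S) (F : Set S) where
  /-- The boundary walk. -/
  walk : List E
  /-- The map of the closed unit disc. -/
  map : ℂ → S
  isClosedDiwalk : H.IsClosedDiwalk walk
  continuousOn : ContinuousOn map (Metric.closedBall 0 1)
  isEmbedding : Topology.IsEmbedding ((Metric.ball (0 : ℂ) 1).domRestrict map)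
  image_ball : map '' Metric.ball 0 1 = F
  map_turn : ∀ (j : Fin walk.length) (t : unitInterval),
    map (turn ((j + t) / walk.length)) = φ.edge (walk.get j) t

theorem BoundedBy.exists_faceDisc {φ : H.GraphEmbedding S} {F : Set S} {w : List E}
    (h : φ.BoundedBy F w) : ∃ D : φ.FaceDisc F, D.walk = w := by
  obtain ⟨hw, Φ, hc, he, hi, hb⟩ := h
  refine ⟨⟨w, Φ, hw, hc, he, hi, fun j t => ?_⟩, rfl⟩
  rw [← hb j t, turn]
  push_cast
  rfl

variable {φ : H.GraphEmbedding S}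

theorem edge_mem_carrier (e : E) (t : unitInterval) : φ.edge e t ∈ φ.carrier :=
  Or.inr (Set.mem_iUnion.2 ⟨e, t, rfl⟩)

theorem vert_mem_carrier (v : V) : φ.vert v ∈ φ.carrier := Or.inl ⟨v, rfl⟩

theorem isClosed_range_edge [T2Space S] (e : E) : IsClosed (Set.range (φ.edge e)) :=
  (isCompact_range (φ.edge e).continuous).isClosed

theorem isClosed_carrier [T2Space S] [Finite V] [Finite E] : IsClosed φ.carrier :=
  (Set.finite_range _).isClosed.union (isClosed_iUnion_of_finite fun e => isClosed_range_edge e)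

theorem IsFace.notMem_carrier {F : Set S} (hF : φ.IsFace F) {x : S} (hx : x ∈ F) :
    x ∉ φ.carrier := by
  obtain ⟨y, hy, rfl⟩ := hF
  exact connectedComponentIn_subset _ _ hx

theorem IsFace.eq_of_mem {F F' : Set S} (hF : φ.IsFace F) (hF' : φ.IsFace F') {x : S}
    (hx : x ∈ F) (hx' : x ∈ F') : F = F' := by
  obtain ⟨y, hy, rfl⟩ := hF
  obtain ⟨y', hy', rfl⟩ := hF'
  rw [connectedComponentIn_eq hx, connectedComponentIn_eq hx']

theorem IsFace.isOpen [T2Space S] [LocallyConnectedSpace S] [Finite V] [Finite E] {F : Set S}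
    (hF : φ.IsFace F) : IsOpen F := by
  obtain ⟨y, hy, rfl⟩ := hF
  exact isClosed_carrier.isOpen_compl.connectedComponentIn

theorem exists_isFace_of_notMem {x : S} (hx : x ∉ φ.carrier) : ∃ F, φ.IsFace F ∧ x ∈ F :=
  ⟨_, ⟨x, hx, rfl⟩, mem_connectedComponentIn hx⟩

namespace FaceDisc

variable {F : Set S} (D : φ.FaceDisc F)

theorem length_pos : 0 < D.walk.length := D.isClosedDiwalk.1

theorem map_mem {z : ℂ} (hz : ‖z‖ < 1) : D.map z ∈ F :=
  D.image_ball.subset ⟨z, by simpa using hz, rfl⟩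

theorem exists_map_eq_edge {z : ℂ} (hz : ‖z‖ = 1) :
    ∃ e ∈ D.walk, ∃ t, D.map z = φ.edge e t := by
  obtain ⟨j, t, rfl⟩ := exists_turn_eq hz D.length_pos
  exact ⟨D.walk.get j, List.get_mem _ _, t, D.map_turn j t⟩

theorem exists_edge_eq_map {e : E} (he : e ∈ D.walk) (t : unitInterval) :
    ∃ z, ‖z‖ = 1 ∧ D.map z = φ.edge e t := by
  obtain ⟨j, rfl⟩ := List.get_of_mem he
  exact ⟨_, norm_turn _, D.map_turn j t⟩

theorem map_mem_carrier {z : ℂ} (hz : ‖z‖ = 1) : D.map z ∈ φ.carrier := by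
  obtain ⟨e, -, t, h⟩ := D.exists_map_eq_edge hz
  exact h ▸ edge_mem_carrier e t

theorem map_mem_or {z : ℂ} (hz : z ∈ Metric.closedBall (0 : ℂ) 1) :
    D.map z ∈ F ∨ D.map z ∈ φ.carrier := by
  rw [mem_closedBall_zero_iff] at hz
  rcases hz.lt_or_eq with h | h
  · exact Or.inl (D.map_mem h)
  · exact Or.inr (D.map_mem_carrier h)

/-- A point of the closed disc is the only one that is mapped to its image, if it is interior. -/
theorem eq_of_map_eq (hF : φ.IsFace F) {z z' : ℂ} (hz : ‖z‖ < 1)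
    (hz' : z' ∈ Metric.closedBall (0 : ℂ) 1) (h : D.map z' = D.map z) : z' = z := by
  rw [mem_closedBall_zero_iff] at hz'
  rcases hz'.lt_or_eq with h1 | h1
  · have := D.isEmbedding.injective (a₁ := ⟨z', by simpa using h1⟩) (a₂ := ⟨z, by simpa using hz⟩)
      h
    exact congrArg Subtype.val this
  · exact absurd (h ▸ D.map_mem_carrier h1) (hF.notMem_carrier (D.map_mem hz))

theorem isClosed_image [T2Space S] : IsClosed (D.map '' Metric.closedBall 0 1) :=
  ((isCompact_closedBall _ _).image_of_continuousOn D.continuousOn).isClosed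

theorem subset_image : F ⊆ D.map '' Metric.closedBall 0 1 :=
  D.image_ball.superset.trans (Set.image_mono Metric.ball_subset_closedBall)

/-- The inverse of the disc map, on the open disc. -/
theorem exists_inverse : ∃ N : S → ℂ, ContinuousOn N F ∧ ∀ x ∈ F, ‖N x‖ < 1 ∧ D.map (N x) = x := by
  classical
  have hx : ∀ x ∈ F, ∃ z : ℂ, ‖z‖ < 1 ∧ D.map z = x := fun x hx => by
    obtain ⟨z, hz, h⟩ := D.image_ball.superset hx
    exact ⟨z, by simpa using hz, h⟩
  choose! N hN using hx
  refine ⟨N, ?_, hN⟩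
  rw [continuousOn_iff_continuous_domRestrict]
  have : Continuous fun x : F => (⟨N x, by simpa using (hN x x.2).1⟩ : Metric.ball (0 : ℂ) 1) :=
    D.isEmbedding.continuous_iff.2 (continuous_subtype_val.congr fun x => ((hN x x.2).2).symm)
  exact continuous_subtype_val.comp this

/-- The increment of the logarithm of a function around the boundary of a face is the sum of its
increments along the edges of the boundary walk. -/
theorem log_turn_sub {f : S → ℂ} {δ : E → ℂ}
    (hδ : ∀ e, HasLogIncrement (fun t => f (φ.edge e t)) (δ e)) {L : ℝ → ℂ} (hL : Continuous L)
    (hexp : ∀ θ, Complex.exp (L θ) = f (D.map (turn θ))) :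
    L 1 - L 0 = (D.walk.map δ).sum := by
  set n := D.walk.length with hn
  have hn0 : (n : ℝ) ≠ 0 := by exact_mod_cast D.length_pos.ne'
  have hj : ∀ j : Fin n, L (((j : ℕ) + 1 : ℕ) / n) - L ((j : ℕ) / n) = δ (D.walk.get j) := by
    intro j
    refine HasLogIncrement.unique ⟨fun t : unitInterval => L ((j + t) / n), by fun_prop,
      fun t => ?_, ?_⟩ (hδ (D.walk.get j))
    · rw [hexp, D.map_turn j t]
    · simp
  have h1 : (D.walk.map δ).sum = ∑ j : Fin n, δ (D.walk.get j) := by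
    conv_lhs => rw [← List.ofFn_get D.walk, List.map_ofFn, List.sum_ofFn]
    rfl
  rw [h1, ← Finset.sum_congr rfl fun j _ => hj j,
    Fin.sum_univ_eq_sum_range (fun j => L ((j + 1 : ℕ) / n) - L ((j : ℕ) / n)),
    Finset.sum_range_sub (fun j : ℕ => L (j / n))]
  simp [hn0]

end FaceDisc

end GraphEmbedding

end MultiDigraph

namespace MultiDigraph

namespace GraphEmbedding

/-! ### The two sides of an edge -/

variable {V E : Type*} {H : MultiDigraph V E} {S : Type*} [TopologicalSpace S]

/-- The image of the graph with the edge `e` deleted. -/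
def carrierSans (φ : H.GraphEmbedding S) (e : E) : Set S :=
  Set.range φ.vert ∪ ⋃ e' ∈ {e' | e' ≠ e}, Set.range (φ.edge e')

variable {φ : H.GraphEmbedding S}

theorem vert_mem_carrierSans (e : E) (v : V) : φ.vert v ∈ φ.carrierSans e := Or.inl ⟨v, rfl⟩

theorem edge_mem_carrierSans {e e' : E} (h : e' ≠ e) (t : unitInterval) :
    φ.edge e' t ∈ φ.carrierSans e :=
  Or.inr (Set.mem_biUnion (x := e') h ⟨t, rfl⟩)

theorem carrierSans_subset (e : E) : φ.carrierSans e ⊆ φ.carrier := by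
  rintro x (hx | hx)
  · exact Or.inl hx
  · obtain ⟨e', -, t, rfl⟩ := Set.mem_iUnion₂.1 hx
    exact edge_mem_carrier e' t

theorem eq_zero_or_one_or_mem_Ioo (t : unitInterval) :
    t = 0 ∨ t = 1 ∨ t ∈ Set.Ioo (0 : unitInterval) 1 := by
  rcases (unitInterval.nonneg' (t := t)).eq_or_lt with h | h
  · exact Or.inl h.symm
  rcases (unitInterval.le_one' (t := t)).eq_or_lt with h' | h'
  · exact Or.inr (Or.inl h')
  · exact Or.inr (Or.inr ⟨h, h'⟩)

/-- An interior point of an edge lies on no other edge, and is no vertex. -/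
theorem edge_interior_notMem_carrierSans {e : E} {t : unitInterval}
    (ht : t ∈ Set.Ioo (0 : unitInterval) 1) : φ.edge e t ∉ φ.carrierSans e := by
  rintro (⟨v, hv⟩ | h)
  · exact φ.edge_interior_ne_vert e t v ht hv.symm
  · obtain ⟨e', he', s, hs⟩ := Set.mem_iUnion₂.1 h
    rcases eq_zero_or_one_or_mem_Ioo s with rfl | rfl | h'
    · exact φ.edge_interior_ne_vert e t _ ht (hs.symm.trans (φ.edge e').source)
    · exact φ.edge_interior_ne_vert e t _ ht (hs.symm.trans (φ.edge e').target)
    · exact he' (φ.edge_interior_injective e' e s t h' ht hs).1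

theorem eq_of_edge_interior_eq {e e' : E} {t s : unitInterval}
    (ht : t ∈ Set.Ioo (0 : unitInterval) 1) (h : φ.edge e t = φ.edge e' s) : e' = e := by
  by_contra hne
  exact edge_interior_notMem_carrierSans ht (h ▸ edge_mem_carrierSans hne s)

theorem isCompact_carrierSans [T2Space S] [Finite V] [Finite E] (e : E) :
    IsCompact (φ.carrierSans e) :=
  (Set.finite_range _).isCompact.union
    ((Set.toFinite _).isCompact_biUnion fun e' _ => isCompact_range (φ.edge e').continuous)

/-- A function that has a logarithm on the graph without the edge `e` has an integral class `k`
on the graph: its logarithm changes by `2πi` times `k` times the number of passages through `e`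
around any face. -/
theorem HasLogOn.exists_int_log_turn_sub [DecidableEq E] {f : S → ℂ}
    (hf : ContinuousOn f φ.carrier) (h0 : ∀ x ∈ φ.carrier, f x ≠ 0) {e : E}
    (hlog : HasLogOn f (φ.carrierSans e)) :
    ∃ k : ℤ, ∀ (F : Set S) (D : φ.FaceDisc F) (L : ℝ → ℂ), Continuous L →
      (∀ θ, Complex.exp (L θ) = f (D.map (turn θ))) →
      L 1 - L 0 = k * D.walk.count e * (2 * Real.pi * Complex.I) := by
  obtain ⟨ℓ, hℓ, hexp⟩ := hlog
  obtain ⟨m, hm, hmexp⟩ : ∃ m : ℝ → ℂ, Continuous m ∧ ∀ t,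
      Complex.exp (m t) = f (φ.edge e (Set.projIcc 0 1 zero_le_one t)) :=
    exists_continuous_log (hf.comp_continuous ((φ.edge e).continuous.comp continuous_projIcc)
      fun t => edge_mem_carrier e _) fun t => h0 _ (edge_mem_carrier e _)
  have hmexp' : ∀ t : unitInterval, Complex.exp (m t) = f (φ.edge e t) := fun t => by
    rw [hmexp, Set.projIcc_val]
  obtain ⟨k₀, hk₀⟩ := Complex.exp_eq_exp_iff_exists_int.1 (show Complex.exp (m 0) =
      Complex.exp (ℓ (φ.vert (H.tail e))) by
    rw [hexp _ (vert_mem_carrierSans e _)]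
    simpa using hmexp' 0)
  obtain ⟨k₁, hk₁⟩ := Complex.exp_eq_exp_iff_exists_int.1 (show Complex.exp (m 1) =
      Complex.exp (ℓ (φ.vert (H.head e))) by
    rw [hexp _ (vert_mem_carrierSans e _)]
    simpa using hmexp' 1)
  have hδ : ∀ e', HasLogIncrement (fun t => f (φ.edge e' t))
      ((ℓ (φ.vert (H.head e')) - ℓ (φ.vert (H.tail e'))) +
        if e' = e then (k₁ - k₀) * (2 * Real.pi * Complex.I) else 0) := by
    intro e'
    by_cases h : e' = e
    · subst h
      refine ⟨fun t => m t, by fun_prop, hmexp', ?_⟩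
      simp only [Set.Icc.coe_one, Set.Icc.coe_zero, hk₀, hk₁, if_pos]
      ring
    · refine ⟨fun t => ℓ (φ.edge e' t), ?_, fun t => hexp _ (edge_mem_carrierSans h t), ?_⟩
      · exact hℓ.comp_continuous (φ.edge e').continuous (edge_mem_carrierSans h)
      · simp [h]
  refine ⟨k₁ - k₀, fun F D L hL hLexp => ?_⟩
  rw [D.log_turn_sub hδ hL hLexp, List.sum_map_add,
    D.isClosedDiwalk.sum_sub_eq_zero fun v => ℓ (φ.vert v), zero_add, List.sum_map_ite_eq,
    nsmul_eq_mul, List.map_const', List.sum_replicate, smul_zero, add_zero]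
  push_cast
  ring

/-- Around a face, the logarithm of a function without zeros on the closed face does not change. -/
theorem FaceDisc.exists_log_of_ne_zero {F : Set S} (D : φ.FaceDisc F) {f : S → ℂ}
    (hf : ContinuousOn f (D.map '' Metric.closedBall 0 1))
    (h0 : ∀ x ∈ D.map '' Metric.closedBall 0 1, f x ≠ 0) :
    ∃ L : ℝ → ℂ, Continuous L ∧ (∀ θ, Complex.exp (L θ) = f (D.map (turn θ))) ∧ L 1 - L 0 = 0 := by
  obtain ⟨ℓ, hℓ, hexp⟩ := exists_continuous_log_closedBall
    (hf.comp D.continuousOn (Set.mapsTo_image _ _)) fun z hz => h0 _ ⟨z, hz, rfl⟩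
  refine ⟨fun θ => ℓ (turn θ), hℓ.comp continuous_turn, fun θ => hexp _ (turn_mem_closedBall θ),
    by simp [turn_zero, turn_one]⟩

/-- The centre of a face can be joined, across an edge, to points of an adjacent face that are
arbitrarily close to the centre of that face. -/
theorem FaceDisc.joinedIn_of_mem_walk {F₁ F₂ : Set S} (D₁ : φ.FaceDisc F₁) (D₂ : φ.FaceDisc F₂)
    (h₁ : φ.IsFace F₁) (h₂ : φ.IsFace F₂) (hne : F₁ ≠ F₂) {e : E} (he₁ : e ∈ D₁.walk)
    (he₂ : e ∈ D₂.walk) {U : Set S} (hU : U ∈ nhds (D₁.map 0)) :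
    ∃ y ∈ U, JoinedIn (φ.carrierSans e ∪ {D₁.map 0})ᶜ y (D₂.map 0) := by
  set t : unitInterval := ⟨1 / 2, by norm_num, by norm_num⟩ with ht
  have ht' : t ∈ Set.Ioo (0 : unitInterval) 1 :=
    ⟨Subtype.coe_lt_coe.1 (by norm_num [ht]), Subtype.coe_lt_coe.1 (by norm_num [ht])⟩
  obtain ⟨z₁, hz₁, hp₁⟩ := D₁.exists_edge_eq_map he₁ t
  obtain ⟨z₂, hz₂, hp₂⟩ := D₂.exists_edge_eq_map he₂ t
  have hcar : ∀ {F : Set S}, φ.IsFace F → ∀ {x}, x ∈ F → x ∉ φ.carrierSans e :=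
    fun hF _ hx hx' => hF.notMem_carrier hx (carrierSans_subset e hx')
  have h0 : D₁.map 0 ∈ F₁ := D₁.map_mem (by simp)
  have hnorm : ∀ (z : ℂ), ‖z‖ = 1 → ∀ s : ℝ, 0 ≤ s → ‖(s : ℂ) * z‖ = s := fun z hz s hs => by
    rw [norm_mul, hz, mul_one, Complex.norm_real, Real.norm_of_nonneg hs]
  have hcont : ∀ {F : Set S} (D : φ.FaceDisc F) {z : ℂ}, ‖z‖ = 1 →
      ContinuousOn (fun s : ℝ => D.map (s * z)) (Set.Icc 0 1) := fun D z hz =>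
    D.continuousOn.comp (by fun_prop) fun s hs => by
      rw [mem_closedBall_zero_iff, hnorm z hz s hs.1]; exact hs.2
  -- a short initial piece of the radius of the first disc is mapped into `U`
  obtain ⟨δ, hδ0, hδ1, hδU⟩ : ∃ δ : ℝ, 0 < δ ∧ δ < 1 ∧ D₁.map (δ * z₁) ∈ U := by
    have hc : Filter.Tendsto (fun s : ℝ => D₁.map (s * z₁)) (nhdsWithin 0 (Set.Icc 0 1))
        (nhds (D₁.map 0)) := by
      simpa using (hcont D₁ hz₁ 0 (by simp)).tendsto
    have hev := (hc.mono_left (nhdsWithin_mono 0 Set.Ioo_subset_Icc_self)) hU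
    have hne : (nhdsWithin (0 : ℝ) (Set.Ioo 0 1)).NeBot := by
      rw [nhdsWithin_Ioo_eq_nhdsGT one_pos]; infer_instance
    obtain ⟨δ, hδ, hδ'⟩ := Filter.nonempty_of_mem (Filter.inter_mem (Filter.mem_map.1 hev)
      self_mem_nhdsWithin)
    exact ⟨δ, hδ'.1, hδ'.2, hδ⟩
  have hj : ∀ {F : Set S} (D : φ.FaceDisc F) (_ : φ.IsFace F) {z : ℂ} (_ : ‖z‖ = 1)
      (_ : D.map z = φ.edge e t) (s : ℝ) (_ : 0 ≤ s) (_ : s ≤ 1)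
      (_ : ∀ r ∈ Set.Icc s 1, D.map (r * z) ≠ D₁.map 0),
      JoinedIn (φ.carrierSans e ∪ {D₁.map 0})ᶜ (D.map (s * z)) (φ.edge e t) := by
    intro F D hF z hz hp s hs0 hs1 havoid
    have hpc : IsPathConnected ((fun r : ℝ => D.map (r * z)) '' Set.Icc s 1) :=
      ((convex_Icc s 1).isPathConnected ⟨s, by simp [hs1]⟩).image'
        ((hcont D hz).mono (Set.Icc_subset_Icc_left hs0))
    refine (hpc.joinedIn _ ⟨s, by simp [hs1], rfl⟩ _ ⟨1, by simp [hs1], by simpa using hp⟩).mono ?_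
    rintro _ ⟨r, hr, rfl⟩ (h | h)
    · rcases hr.2.lt_or_eq with h1 | h1
      · exact hcar hF (D.map_mem (by rw [hnorm z hz r (hs0.trans hr.1)]; exact h1)) h
      · subst h1
        simp only [Complex.ofReal_one, one_mul, hp] at h
        exact edge_interior_notMem_carrierSans ht' h
    · exact havoid r hr h
  have hJ₁ := hj D₁ h₁ hz₁ hp₁ δ hδ0.le hδ1.le fun r hr h => by
    have h2 := hnorm z₁ hz₁ r (hδ0.le.trans hr.1)
    rw [D₁.eq_of_map_eq h₁ (z := 0) (by simp)
      (by rw [mem_closedBall_zero_iff, h2]; exact hr.2) h, norm_zero] at h2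
    linarith [hr.1]
  have hJ₂ := hj D₂ h₂ hz₂ hp₂ 0 le_rfl zero_le_one fun r hr h => by
    rcases D₂.map_mem_or (z := r * z₂) (by
      rw [mem_closedBall_zero_iff, hnorm z₂ hz₂ r hr.1]; exact hr.2) with h' | h'
    · exact hne (h₁.eq_of_mem h₂ h0 (h ▸ h'))
    · exact h₁.notMem_carrier h0 (h ▸ h')
  rw [Complex.ofReal_zero, zero_mul] at hJ₂
  exact ⟨_, hδU, hJ₁.trans hJ₂.symm⟩

variable [SphereLike S] [Finite V] [Finite E]

/-- In the plane obtained by removing the centre of a face, the position relative to the centre of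
an adjacent face has a continuous logarithm on the graph without a common edge of the two faces. -/
theorem FaceDisc.hasLogOn_carrierSans {F₁ F₂ : Set S} (D₁ : φ.FaceDisc F₁) (D₂ : φ.FaceDisc F₂)
    (h₁ : φ.IsFace F₁) (h₂ : φ.IsFace F₂) (hne : F₁ ≠ F₂) {e : E} (he₁ : e ∈ D₁.walk)
    (he₂ : e ∈ D₂.walk) (κ : PlaneChart S (D₁.map 0)) :
    HasLogOn (fun x => κ.toFun x - κ.toFun (D₂.map 0)) (φ.carrierSans e) := by
  have h0 : D₁.map 0 ∈ F₁ := D₁.map_mem (by simp)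
  have hsub : φ.carrierSans e ⊆ {D₁.map 0}ᶜ := fun x hx h =>
    h₁.notMem_carrier h0 (carrierSans_subset e (h ▸ hx))
  have hψ := κ.continuousOn_toFun.mono hsub
  obtain ⟨R, hR⟩ := ((isCompact_carrierSans e).image_of_continuousOn hψ).isBounded.subset_ball 0
  have hU : (κ.inv '' Metric.closedBall 0 R)ᶜ ∈ nhds (D₁.map 0) := by
    refine IsOpen.mem_nhds ?_ ?_
    · exact ((isCompact_closedBall _ _).image κ.continuous_inv).isClosed.isOpen_compl
    · rintro ⟨z, -, hz⟩
      exact κ.inv_ne z hz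
  obtain ⟨y, hy, hJ⟩ := D₁.joinedIn_of_mem_walk D₂ h₁ h₂ hne he₁ he₂ hU
  have hyb : y ≠ D₁.map 0 := fun h => hJ.source_mem (Or.inr h)
  have hJ' : JoinedIn (κ.toFun '' φ.carrierSans e)ᶜ (κ.toFun y) (κ.toFun (D₂.map 0)) := by
    obtain ⟨γ, hγ⟩ := hJ
    have hγb : ∀ t, γ t ∈ ({D₁.map 0} : Set S)ᶜ := fun t h => hγ t (Or.inr h)
    have : PathConnectedSpace unitInterval := isPathConnected_iff_pathConnectedSpace.1
      ((convex_Icc (0 : ℝ) 1).isPathConnected ⟨0, by simp⟩)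
    have hpc : IsPathConnected (κ.toFun '' Set.range γ) :=
      (isPathConnected_range γ.continuous).image'
        (κ.continuousOn_toFun.mono (Set.range_subset_iff.2 hγb))
    refine (hpc.joinedIn _ ⟨y, ⟨0, γ.source⟩, rfl⟩ _ ⟨_, ⟨1, γ.target⟩, rfl⟩).mono ?_
    rintro _ ⟨_, ⟨t, rfl⟩, rfl⟩ ⟨x, hx, hxt⟩
    exact hγ t (Or.inl (κ.injOn (hsub hx) (hγb t) hxt ▸ hx))
  refine HasLogOn.of_joinedIn hψ hJ' (hasLogOn_sub_of_norm_lt hψ fun x hx => ?_)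
  have h1 : ‖κ.toFun x‖ < R := by simpa using hR ⟨x, hx, rfl⟩
  by_contra h2
  exact hy ⟨κ.toFun y, by simpa using (not_lt.1 h2).trans h1.le, κ.left_inv y hyb⟩

/-- An edge on the boundaries of two faces is passed exactly once by each of them, and lies on the
boundary of no third face. -/
theorem FaceDisc.count_eq_one_and_notMem [DecidableEq E] {F₁ F₂ : Set S} (D₁ : φ.FaceDisc F₁)
    (D₂ : φ.FaceDisc F₂) (h₁ : φ.IsFace F₁) (h₂ : φ.IsFace F₂) (hne : F₁ ≠ F₂) {e : E}
    (he₁ : e ∈ D₁.walk) (he₂ : e ∈ D₂.walk) :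
    D₂.walk.count e = 1 ∧ ∀ (F₃ : Set S) (D₃ : φ.FaceDisc F₃), φ.IsFace F₃ → F₃ ≠ F₁ → F₃ ≠ F₂ →
      e ∉ D₃.walk := by
  obtain ⟨κ⟩ := SphereLike.nonempty_planeChart (D₁.map 0)
  have hb : D₁.map 0 ∈ F₁ := D₁.map_mem (by simp)
  have ha : D₂.map 0 ∈ F₂ := D₂.map_mem (by simp)
  have hab : D₂.map 0 ≠ D₁.map 0 := fun h => hne (h₁.eq_of_mem h₂ hb (h ▸ ha))
  set f : S → ℂ := fun x => κ.toFun x - κ.toFun (D₂.map 0) with hfdef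
  have hf : ContinuousOn f {D₁.map 0}ᶜ := κ.continuousOn_toFun.sub continuousOn_const
  have hf0 : ∀ x, x ≠ D₁.map 0 → x ≠ D₂.map 0 → f x ≠ 0 := fun x hx hx' h =>
    hx' (κ.injOn hx hab (sub_eq_zero.1 h))
  obtain ⟨k, hk⟩ := HasLogOn.exists_int_log_turn_sub (φ := φ) (f := f)
    (hf.mono fun x hx h => h₁.notMem_carrier hb (h ▸ hx))
    (fun x hx => hf0 x (fun h => h₁.notMem_carrier hb (h ▸ hx))
      fun h => h₂.notMem_carrier ha (h ▸ hx))
    (D₁.hasLogOn_carrierSans D₂ h₁ h₂ hne he₁ he₂ κ)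
  have hpi := Complex.two_pi_I_ne_zero
  have hb₂ : ∀ z ∈ Metric.closedBall (0 : ℂ) 1, D₂.map z ≠ D₁.map 0 := fun z hz h => by
    rcases D₂.map_mem_or hz with h' | h'
    · exact hne (h₁.eq_of_mem h₂ hb (h ▸ h'))
    · exact h₁.notMem_carrier hb (h ▸ h')
  -- the boundary of the second face winds once around its centre
  have hk2 : k * D₂.walk.count e = 1 ∨ k * D₂.walk.count e = -1 := by
    obtain ⟨N, hNc, hN⟩ := D₂.exists_inverse
    have hopen : IsOpen ((fun u : ℂ => κ.inv (u + κ.toFun (D₂.map 0))) ⁻¹' F₂) :=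
      h₂.isOpen.preimage (by have := κ.continuous_inv; fun_prop)
    obtain ⟨ε, hε, hball⟩ := Metric.isOpen_iff.1 hopen 0 (by
      simp only [Set.mem_preimage, zero_add, κ.left_inv _ hab]; exact ha)
    have hmem : ∀ u ∈ Metric.sphere (0 : ℂ) (ε / 2),
        κ.inv (u + κ.toFun (D₂.map 0)) ∈ F₂ := fun u hu => hball (by
      rw [mem_sphere_zero_iff_norm] at hu
      rw [mem_ball_zero_iff, hu]; linarith)
    obtain ⟨L, hL, hLexp, hL1⟩ := exists_log_turn_of_rightInverse (G := f ∘ D₂.map)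
      (hf.comp D₂.continuousOn hb₂)
      (fun z hz hz0 => hf0 _ (hb₂ z hz) fun h => hz0 (D₂.eq_of_map_eq h₂ (by simp) hz h))
      (half_pos hε) (N := fun u => N (κ.inv (u + κ.toFun (D₂.map 0))))
      (hNc.comp (by have := κ.continuous_inv; fun_prop) hmem)
      (fun u hu => by
        obtain ⟨hN1, hN2⟩ := hN _ (hmem u hu)
        have hfN : f (D₂.map (N (κ.inv (u + κ.toFun (D₂.map 0))))) = u := by
          simp only [hfdef, hN2, κ.right_inv, add_sub_cancel_right]
        refine ⟨by simpa using hN1.le, fun h0 => ?_, hfN⟩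
        simp only [h0, hfdef, sub_self] at hfN
        rw [← hfN] at hu
        simp only [mem_sphere_zero_iff_norm, norm_zero] at hu
        linarith)
    have h := hk F₂ D₂ L hL hLexp
    rw [h] at hL1
    have hc : ∀ c : ℤ, (k * D₂.walk.count e * (2 * Real.pi * Complex.I) : ℂ) =
        c * (2 * Real.pi * Complex.I) → k * D₂.walk.count e = c := fun c hc => by
      exact_mod_cast mul_right_cancel₀ hpi hc
    rcases hL1 with h | h
    · exact Or.inl (hc 1 (by simpa using h))
    · exact Or.inr (hc (-1) (by simpa using h))
  have hkz : k ≠ 0 := by rintro rfl; simp at hk2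
  -- the boundary of a third face does not wind around the centre of the second one
  refine ⟨?_, fun F₃ D₃ h₃ h31 h32 he₃ => ?_⟩
  · have : (D₂.walk.count e : ℤ) ∣ 1 := by
      rcases hk2 with h | h
      · exact ⟨k, by rw [← h, mul_comm]⟩
      · exact ⟨-k, by rw [mul_neg, mul_comm, h, neg_neg]⟩
    have h' := Int.natAbs_dvd_natAbs.2 this
    simpa using h'
  · have hne3 : ∀ {F : Set S}, φ.IsFace F → F₃ ≠ F → ∀ {x}, x ∈ F →
        ∀ z ∈ Metric.closedBall (0 : ℂ) 1, D₃.map z ≠ x := fun hF h3 x hx z hz h => by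
      rcases D₃.map_mem_or hz with h' | h'
      · exact h3 (h₃.eq_of_mem hF h' (h ▸ hx))
      · exact hF.notMem_carrier hx (h ▸ h')
    obtain ⟨L, hL, hLexp, hL1⟩ := D₃.exists_log_of_ne_zero (f := f)
      (hf.mono (by rintro _ ⟨z, hz, rfl⟩; exact hne3 h₁ h31 hb z hz))
      (by rintro _ ⟨z, hz, rfl⟩; exact hf0 _ (hne3 h₁ h31 hb z hz) (hne3 h₂ h32 ha z hz))
    rw [hk F₃ D₃ L hL hLexp] at hL1
    have : (k : ℂ) * D₃.walk.count e = 0 := by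
      simpa [Real.pi_ne_zero, Complex.I_ne_zero] using hL1
    have h' : k * D₃.walk.count e = 0 := by exact_mod_cast this
    rcases mul_eq_zero.1 h' with h' | h'
    · exact hkz h'
    · exact List.count_eq_zero.1 (by exact_mod_cast h') he₃

end GraphEmbedding

end MultiDigraph

/-- If the logarithm of a function on the unit circle does not change along a full turn, then it
extends continuously to the plane. -/
theorem exists_continuous_exp_eq_on_circle {g : ℂ → ℂ} {L : ℝ → ℂ} (hL : Continuous L)
    (hexp : ∀ θ, Complex.exp (L θ) = g (turn θ)) (h01 : L 1 = L 0) :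
    ∃ u : ℂ → ℂ, Continuous u ∧ ∀ z, ‖z‖ = 1 → Complex.exp (u z) = g z := by
  have hper : Function.Periodic L 1 := fun θ => by
    have := sub_eq_sub_of_exp_eq (L := fun θ => L (θ + 1)) (by fun_prop) hL
      (fun θ => by rw [hexp, hexp]; exact_mod_cast congrArg g (turn_add_int θ 1)) θ 0
    simp only [zero_add, h01] at this
    simpa using this
  set ℓ : ℂ → ℂ := fun z => L (z.arg / (2 * Real.pi)) with hℓ
  have hℓt : ∀ θ, ℓ (turn θ) = L θ := fun θ => by
    have h1 : Complex.exp ((turn θ).arg * Complex.I) = turn θ := by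
      have := Complex.norm_mul_exp_arg_mul_I (turn θ)
      rwa [norm_turn, Complex.ofReal_one, one_mul] at this
    obtain ⟨n, hn⟩ := Complex.exp_eq_exp_iff_exists_int.1 (h1.trans (by rw [turn]))
    have hn' : (turn θ).arg = θ * (2 * Real.pi) + n * (2 * Real.pi) := by
      have : (((turn θ).arg : ℝ) : ℂ) = ((θ * (2 * Real.pi) + n * (2 * Real.pi) : ℝ) : ℂ) := by
        apply mul_right_cancel₀ Complex.I_ne_zero
        rw [hn]; push_cast; ring
      exact_mod_cast this
    have h2 : (turn θ).arg / (2 * Real.pi) = θ + n * 1 := by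
      rw [hn']; field_simp
    rw [hℓ]
    simp only [h2]
    exact hper.int_mul n θ
  have himage : turn '' Set.Icc 0 1 = Metric.sphere 0 1 := by
    ext z
    constructor
    · rintro ⟨θ, -, rfl⟩
      simp [norm_turn]
    · intro hz
      obtain ⟨j, t, h⟩ := exists_turn_eq (by simpa using hz) one_pos
      refine ⟨t, t.2, ?_⟩
      rw [← h, Subsingleton.elim j 0]
      simp
  have hℓc : ContinuousOn ℓ (Metric.sphere 0 1) := by
    rw [← himage]
    exact continuousOn_image_of_comp isCompact_Icc continuous_turn.continuousOn
      (hL.continuousOn.congr fun θ _ => hℓt θ)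
  obtain ⟨u, hu⟩ := ContinuousMap.exists_restrict_eq Metric.isClosed_sphere
    ⟨_, hℓc.domRestrict⟩
  refine ⟨u, u.continuous, fun z hz => ?_⟩
  have hz' : z ∈ Metric.sphere (0 : ℂ) 1 := by simpa using hz
  have h1 : u z = ℓ z := congrFun (congrArg DFunLike.coe hu) ⟨z, hz'⟩
  obtain ⟨θ, -, rfl⟩ := himage.superset hz'
  rw [h1, hℓt, hexp]

/-- The extension of a function on the unit circle to the plane that is homogeneous of degree one
on every ray. -/
theorem continuous_norm_mul_radial {g : ℂ → ℂ} (hg : ContinuousOn g (Metric.sphere 0 1)) :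
    Continuous fun z : ℂ => (‖z‖ : ℂ) * g ((‖z‖⁻¹ : ℝ) * z) := by
  have hmem : ∀ z : ℂ, z ≠ 0 → ((‖z‖⁻¹ : ℝ) : ℂ) * z ∈ Metric.sphere (0 : ℂ) 1 := fun z hz => by
    simp [hz]
  rw [continuous_iff_continuousAt]
  intro z
  by_cases hz : z = 0
  · subst hz
    obtain ⟨C, hC⟩ := ((isCompact_sphere (0 : ℂ) 1).image_of_continuousOn hg).isBounded.exists_norm_le
    rw [ContinuousAt]
    simp only [norm_zero, Complex.ofReal_zero, zero_mul]
    refine squeeze_zero_norm (a := fun z : ℂ => ‖z‖ * C) (fun z => ?_) ?_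
    · by_cases hz : z = 0
      · simp [hz]
      · rw [norm_mul, Complex.norm_real, norm_norm]
        exact mul_le_mul_of_nonneg_left (hC _ ⟨_, hmem z hz, rfl⟩) (norm_nonneg _)
    · have : Continuous fun z : ℂ => ‖z‖ * C := by fun_prop
      simpa using this.tendsto 0
  · have hopen : IsOpen ({0}ᶜ : Set ℂ) := isOpen_compl_singleton
    refine ContinuousOn.continuousAt (s := {0}ᶜ) ?_ (hopen.mem_nhds hz)
    refine ContinuousOn.mul (by fun_prop) (hg.comp ?_ hmem)
    refine ContinuousOn.mul ?_ continuousOn_id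
    exact Complex.continuous_ofReal.comp_continuousOn
      (continuous_norm.continuousOn.inv₀ fun z hz => norm_ne_zero_iff.2 hz)

namespace MultiDigraph

namespace GraphEmbedding

/-! ### Potentials -/

variable {V E : Type*} {H : MultiDigraph V E} {S : Type*} [TopologicalSpace S]
  {φ : H.GraphEmbedding S}

/-- A function on the sphere that has at most one zero `b`, and winds `c e` times around `0` along
every edge `e`, shows that `c` is a difference of potentials on the edges that avoid `b`. -/
theorem exists_potential_of_function [SphereLike S] {f : S → ℂ} (hf : Continuous f) {b : S}
    (h0 : ∀ x, x ≠ b → f x ≠ 0) {c : E → ℤ}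
    (hc : ∀ e t, f (φ.edge e t) = Complex.exp (2 * Real.pi * Complex.I * (c e * (t : ℝ)))) :
    ∃ g : V → ℂ, ∀ e, b ∉ Set.range (φ.edge e) → (c e : ℂ) = g (H.head e) - g (H.tail e) := by
  obtain ⟨ℓ, hℓ, hexp⟩ := hasLogOn_compl_singleton hf.continuousOn h0
  refine ⟨fun v => ℓ (φ.vert v) / (2 * Real.pi * Complex.I), fun e he => ?_⟩
  have hb : ∀ t, φ.edge e t ≠ b := fun t h => he ⟨t, h⟩
  have h1 : HasLogIncrement (fun t => f (φ.edge e t))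
      (ℓ (φ.vert (H.head e)) - ℓ (φ.vert (H.tail e))) :=
    ⟨fun t => ℓ (φ.edge e t), hℓ.comp_continuous (φ.edge e).continuous hb,
      fun t => hexp _ (hb t), by simp⟩
  have h2 : HasLogIncrement (fun t => f (φ.edge e t)) (2 * Real.pi * Complex.I * c e) :=
    ⟨fun t => 2 * Real.pi * Complex.I * (c e * (t : ℝ)), by fun_prop, fun t => (hc e t).symm,
      by simp⟩
  have hpi := Complex.two_pi_I_ne_zero
  rw [← sub_div, h1.unique h2]
  field_simp

/-- There is a function on the sphere that winds `c e` times around `0` along every edge `e` and is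
equal to `1` at the vertices. It is of no interest off the graph. -/
theorem exists_edge_function (φ : H.GraphEmbedding S) (c : E → ℤ) : ∃ f : S → ℂ, ∀ e t,
    f (φ.edge e t) = Complex.exp (2 * Real.pi * Complex.I * (c e * (t : ℝ))) := by
  classical
  have hend : ∀ e (t : unitInterval), t ∉ Set.Ioo (0 : unitInterval) 1 →
      Complex.exp (2 * Real.pi * Complex.I * (c e * (t : ℝ))) = 1 := fun e t ht => by
    rcases eq_zero_or_one_or_mem_Ioo t with rfl | rfl | h
    · simp
    · rw [Complex.exp_eq_one_iff]
      exact ⟨c e, by push_cast [Set.Icc.coe_one]; ring⟩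
    · exact absurd h ht
  have hwd : ∀ e e' s t, φ.edge e s = φ.edge e' t →
      Complex.exp (2 * Real.pi * Complex.I * (c e * ((s : ℝ) : ℂ))) =
        Complex.exp (2 * Real.pi * Complex.I * (c e' * ((t : ℝ) : ℂ))) := by
    have key : ∀ e e' s t, s ∈ Set.Ioo (0 : unitInterval) 1 → φ.edge e s = φ.edge e' t →
        e = e' ∧ s = t := fun e e' s t hs h => by
      have ht : t ∈ Set.Ioo (0 : unitInterval) 1 := by
        by_contra ht
        rcases eq_zero_or_one_or_mem_Ioo t with rfl | rfl | h'
        · exact φ.edge_interior_ne_vert e s _ hs (h.trans (φ.edge e').source)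
        · exact φ.edge_interior_ne_vert e s _ hs (h.trans (φ.edge e').target)
        · exact ht h'
      exact φ.edge_interior_injective e e' s t hs ht h
    intro e e' s t h
    by_cases hs : s ∈ Set.Ioo (0 : unitInterval) 1
    · obtain ⟨rfl, rfl⟩ := key e e' s t hs h
      rfl
    · by_cases ht : t ∈ Set.Ioo (0 : unitInterval) 1
      · obtain ⟨rfl, rfl⟩ := key e' e t s ht h.symm
        rfl
      · rw [hend e s hs, hend e' t ht]
  refine ⟨fun x => if h : ∃ p : E × unitInterval, φ.edge p.1 p.2 = x then
    Complex.exp (2 * Real.pi * Complex.I * (c h.choose.1 * ((h.choose.2 : ℝ) : ℂ))) else 1,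
    fun e t => ?_⟩
  have h : ∃ p : E × unitInterval, φ.edge p.1 p.2 = φ.edge e t := ⟨(e, t), rfl⟩
  exact (dif_pos h).trans (hwd _ _ _ _ h.choose_spec)

theorem carrier_eq_iUnion (hv : ∀ v, ∃ e, H.tail e = v) :
    φ.carrier = ⋃ e, Set.range (φ.edge e) := by
  refine Set.union_eq_right.2 ?_
  rintro _ ⟨v, rfl⟩
  obtain ⟨e, rfl⟩ := hv v
  exact Set.mem_iUnion.2 ⟨e, 0, (φ.edge e).source⟩

theorem continuousOn_carrier [T2Space S] [Finite E] (hv : ∀ v, ∃ e, H.tail e = v) {f : S → ℂ}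
    (hf : ∀ e, Continuous fun t => f (φ.edge e t)) : ContinuousOn f φ.carrier := by
  rw [carrier_eq_iUnion hv]
  refine (locallyFinite_of_finite _).continuousOn_iUnion isClosed_range_edge fun e => ?_
  rw [← Set.image_univ]
  exact continuousOn_image_of_comp isCompact_univ (φ.edge e).continuous.continuousOn
    (hf e).continuousOn

/-- On the sphere, a function on the edges whose sum vanishes along the boundary walks of all faces
except possibly one is a difference of potentials. Such a function prescribes winding numbers along
the edges of a map from the graph to the punctured plane; the map extends over the faces with
vanishing sum and over the punctured exceptional face, and hence has a logarithm. -/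
theorem exists_potential [SphereLike S] [Finite V] [Finite E] [Finite {F // φ.IsFace F}]
    (hv : ∀ v, ∃ e, H.tail e = v) (D : ∀ i : {F // φ.IsFace F}, φ.FaceDisc i.1)
    (i₁ : {F // φ.IsFace F}) {c : E → ℤ} (hc : ∀ i, i ≠ i₁ → ((D i).walk.map c).sum = 0) :
    ∃ g : V → ℂ, ∀ e, (c e : ℂ) = g (H.head e) - g (H.tail e) := by
  classical
  obtain ⟨f₀, hf₀⟩ := φ.exists_edge_function c
  have hf₀c : ContinuousOn f₀ φ.carrier := continuousOn_carrier hv fun e => by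
    simp_rw [hf₀]; fun_prop
  have hf₀0 : ∀ x ∈ φ.carrier, f₀ x ≠ 0 := fun x hx => by
    rw [carrier_eq_iUnion hv] at hx
    obtain ⟨e, t, rfl⟩ := Set.mem_iUnion.1 hx
    rw [hf₀]
    exact Complex.exp_ne_zero _
  have hcirc : ∀ i, ContinuousOn (fun z => f₀ ((D i).map z)) (Metric.sphere 0 1) := fun i =>
    hf₀c.comp ((D i).continuousOn.mono Metric.sphere_subset_closedBall)
      fun z hz => (D i).map_mem_carrier (by simpa using hz)
  -- on each closed disc, the map is extended from the circle, with a zero only at the centre of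
  -- the exceptional disc
  have hdisc : ∀ i, ∃ u : ℂ → ℂ, Continuous u ∧ (∀ z, ‖z‖ = 1 → u z = f₀ ((D i).map z)) ∧
      ∀ z, (i = i₁ → z ≠ 0) → u z ≠ 0 := by
    intro i
    by_cases hi : i = i₁
    · refine ⟨_, continuous_norm_mul_radial (hcirc i), fun z hz => by simp [hz], fun z hz => ?_⟩
      have hz' := hz hi
      refine mul_ne_zero (by simpa using hz') (hf₀0 _ ((D i).map_mem_carrier ?_))
      simp [hz']
    · obtain ⟨L, hL, hexp⟩ := exists_continuous_log (f := fun θ : ℝ => f₀ ((D i).map (turn θ)))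
        ((hcirc i).comp_continuous continuous_turn fun θ => by simp [norm_turn])
        fun θ => hf₀0 _ ((D i).map_mem_carrier (norm_turn θ))
      have hsum := (D i).log_turn_sub (f := f₀)
        (δ := fun e => 2 * Real.pi * Complex.I * c e)
        (fun e => ⟨fun t => 2 * Real.pi * Complex.I * (c e * (t : ℝ)), by fun_prop,
          fun t => (hf₀ e t).symm, by simp⟩) hL hexp
      have h0 : (((D i).walk.map fun e => (c e : ℂ))).sum = 0 := by
        have := congrArg (Int.cast : ℤ → ℂ) (hc i hi)
        rw [Int.cast_list_sum, List.map_map] at this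
        simpa [Function.comp_def] using this
      rw [List.sum_map_mul_left, h0, mul_zero, sub_eq_zero] at hsum
      obtain ⟨u, hu, huexp⟩ := exists_continuous_exp_eq_on_circle
        (g := fun z => f₀ ((D i).map z)) hL hexp hsum
      exact ⟨fun z => Complex.exp (u z), by fun_prop, huexp, fun z _ => Complex.exp_ne_zero _⟩
  choose u hu hu1 hu0 using hdisc
  choose N _ hN using fun i => (D i).exists_inverse
  let f : S → ℂ := fun x =>
    if h : ∃ i : {F // φ.IsFace F}, x ∈ i.1 then u h.choose (N h.choose x) else f₀ x
  have hfcar : ∀ x ∈ φ.carrier, f x = f₀ x := fun x hx => by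
    simp only [f]
    rw [dif_neg]
    rintro ⟨i, hi⟩
    exact i.2.notMem_carrier hi hx
  have hfface : ∀ (i : {F // φ.IsFace F}) x, x ∈ i.1 → f x = u i (N i x) := fun i x hx => by
    have h : ∃ i : {F // φ.IsFace F}, x ∈ i.1 := ⟨i, hx⟩
    have hi : h.choose = i := Subtype.ext (h.choose.2.eq_of_mem i.2 h.choose_spec hx)
    simp only [f]
    rw [dif_pos h, hi]
  have hfdisc : ∀ i, ∀ z ∈ Metric.closedBall (0 : ℂ) 1, f ((D i).map z) = u i z := by
    intro i z hz
    rw [mem_closedBall_zero_iff] at hz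
    rcases hz.lt_or_eq with h | h
    · have hm := (D i).map_mem h
      have hNm := hN i _ hm
      rw [hfface i _ hm, (D i).eq_of_map_eq i.2 h (by simpa using hNm.1.le) hNm.2]
    · rw [hfcar _ ((D i).map_mem_carrier h), hu1 i z h]
  have hcover : φ.carrier ∪ ⋃ i, (D i).map '' Metric.closedBall 0 1 = Set.univ := by
    rw [Set.eq_univ_iff_forall]
    intro x
    by_cases hx : x ∈ φ.carrier
    · exact Or.inl hx
    · obtain ⟨F, hF, hxF⟩ := exists_isFace_of_notMem hx
      exact Or.inr (Set.mem_iUnion.2 ⟨⟨F, hF⟩, (D ⟨F, hF⟩).subset_image hxF⟩)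
  have hfc : Continuous f := by
    rw [← continuousOn_univ, ← hcover]
    refine (hf₀c.congr hfcar).union_of_isClosed ?_ isClosed_carrier
      (isClosed_iUnion_of_finite fun i => (D i).isClosed_image)
    refine (locallyFinite_of_finite _).continuousOn_iUnion (fun i => (D i).isClosed_image)
      fun i => ?_
    exact continuousOn_image_of_comp (isCompact_closedBall _ _) (D i).continuousOn
      ((hu i).continuousOn.congr fun z hz => hfdisc i z hz)
  have h0mem : (D i₁).map 0 ∈ i₁.1 := (D i₁).map_mem (by simp)
  obtain ⟨g, hg⟩ := exists_potential_of_function (φ := φ) hfc (b := (D i₁).map 0) (c := c)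
    (fun x hx => by
      by_cases hxc : x ∈ φ.carrier
      · rw [hfcar x hxc]
        exact hf₀0 x hxc
      · obtain ⟨F, hF, hxF⟩ := exists_isFace_of_notMem hxc
        rw [hfface ⟨F, hF⟩ x hxF]
        refine hu0 _ _ fun hi hz => hx ?_
        have := (hN ⟨F, hF⟩ x hxF).2
        rw [hz, hi] at this
        exact this.symm)
    (fun e t => by rw [hfcar _ (edge_mem_carrier e t), hf₀])
  refine ⟨g, fun e => hg e ?_⟩
  rintro ⟨t, ht⟩
  exact i₁.2.notMem_carrier h0mem (ht ▸ edge_mem_carrier e t)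

end GraphEmbedding

end MultiDigraph

/-! ### Cuts and face systems -/

namespace MultiDigraph

variable {V E : Type*} {H : MultiDigraph V E}

/-- Along a directed walk, a potential whose change along every edge is a natural number changes by
a natural number. -/
theorem ReachableAvoiding.exists_nat_sub {F : Finset E} {u v : V}
    (h : H.ReachableAvoiding F u v) {g : V → ℂ}
    (hg : ∀ e, e ∉ F → ∃ n : ℕ, g (H.head e) - g (H.tail e) = n) : ∃ n : ℕ, g v - g u = n := by
  induction h with
  | refl => exact ⟨0, by simp⟩
  | tail _ h ih =>
    obtain ⟨n, hn⟩ := ih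
    obtain ⟨e, he, rfl, rfl⟩ := h
    obtain ⟨m, hm⟩ := hg e he
    exact ⟨n + m, by push_cast; rw [← hn, ← hm]; ring⟩

/-- No potential increases by one along `e` and changes by natural numbers only along the edges
outside a set `F` of fewer than `k` edges: a walk avoiding `F` leads from the head of `e` back to
its tail. -/
theorem IsStronglyEdgeConnected.false_of_potential {k : ℕ} (hconn : H.IsStronglyEdgeConnected k)
    {F : Finset E} (hF : F.card < k) {g : V → ℂ} {e : E} (he : g (H.head e) - g (H.tail e) = 1)
    (hg : ∀ e, e ∉ F → ∃ n : ℕ, g (H.head e) - g (H.tail e) = n) : False := by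
  obtain ⟨n, hn⟩ := (hconn F hF (H.head e) (H.tail e)).exists_nat_sub hg
  have h : ((n + 1 : ℕ) : ℂ) = 0 := by
    push_cast
    rw [← hn, ← he]
    ring
  exact Nat.cast_ne_zero.2 n.succ_ne_zero h

theorem IsTwoRegular.exists_tail_eq (hreg : H.IsTwoRegular) (v : V) : ∃ e, H.tail e = v := by
  have h : {e : E | H.tail e = v}.Nonempty := by
    rw [← Set.ncard_pos (Set.finite_of_ncard_pos (by rw [(hreg v).1]; exact two_pos)),
      (hreg v).1]
    exact two_pos
  exact h

theorem IsTwoRegular.exists_ne_tail_eq (hreg : H.IsTwoRegular) (e : E) :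
    ∃ e', e' ≠ e ∧ H.tail e' = H.tail e := by
  obtain ⟨a, b, hab, h⟩ := Set.ncard_eq_two.1 (hreg (H.tail e)).1
  have ha : a ∈ {e' : E | H.tail e' = H.tail e} := h ▸ Or.inl rfl
  have hb : b ∈ {e' : E | H.tail e' = H.tail e} := h ▸ Or.inr rfl
  by_cases hae : a = e
  · exact ⟨b, fun hbe => hab (hae.trans hbe.symm), hb⟩
  · exact ⟨a, hae, ha⟩

/-- The properties of the boundary walks of the faces of an embedding in the sphere that determine
them: every edge is passed twice, by distinct walks; a function on the edges whose sum vanishes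
along all walks but one is a difference of potentials; and the walks cannot be separated into two
classes without a common edge. -/
structure IsFaceSystem (H : MultiDigraph V E) {ι : Type*} (walk : ι → List E) : Prop where
  isClosedDiwalk : ∀ i, H.IsClosedDiwalk (walk i)
  nodup : ∀ i, (walk i).Nodup
  exists_two : ∀ e, ∃ i j, i ≠ j ∧ e ∈ walk i ∧ e ∈ walk j ∧ ∀ k, e ∈ walk k → k = i ∨ k = j
  exists_potential : ∀ (i₁ : ι) (c : E → ℤ), (∀ i, i ≠ i₁ → ((walk i).map c).sum = 0) →
    ∃ g : V → ℂ, ∀ e, (c e : ℂ) = g (H.head e) - g (H.tail e)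
  eq_univ_of_closed : ∀ A : Set ι, A.Nonempty →
    (∀ i j e, e ∈ walk i → e ∈ walk j → i ∈ A → j ∈ A) → A = Set.univ

namespace GraphEmbedding

/-! ### The faces of an embedding in the sphere -/

variable {S : Type*} [TopologicalSpace S] {φ : H.GraphEmbedding S}

/-- The graph does not fill the sphere. Otherwise the map that winds once along a single edge is
defined on the whole sphere, and has a logarithm off an interior point of any other edge. -/
theorem exists_isFace [SphereLike S] [Nonempty S] [Finite V] [Finite E] (hreg : H.IsTwoRegular)
    (hconn : H.IsStronglyEdgeConnected 2) (φ : H.GraphEmbedding S) : ∃ F, φ.IsFace F := by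
  classical
  by_contra hno
  have huniv : ∀ x, x ∈ φ.carrier := fun x => by
    by_contra hx
    exact hno ⟨_, (exists_isFace_of_notMem hx).choose_spec.1⟩
  obtain ⟨x⟩ := ‹Nonempty S›
  have hx := huniv x
  rw [carrier_eq_iUnion hreg.exists_tail_eq] at hx
  obtain ⟨e, -⟩ := Set.mem_iUnion.1 hx
  obtain ⟨e₂, he₂, -⟩ := hreg.exists_ne_tail_eq e
  obtain ⟨f, hf⟩ := φ.exists_edge_function (fun e' => if e' = e then 1 else 0)
  have hfc : Continuous f := by
    rw [← continuousOn_univ, ← Set.eq_univ_of_forall huniv]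
    exact continuousOn_carrier hreg.exists_tail_eq fun e => by simp_rw [hf]; fun_prop
  have hf0 : ∀ x, f x ≠ 0 := fun x => by
    have hx := huniv x
    rw [carrier_eq_iUnion hreg.exists_tail_eq] at hx
    obtain ⟨e', t, rfl⟩ := Set.mem_iUnion.1 hx
    rw [hf]
    exact Complex.exp_ne_zero _
  set t : unitInterval := ⟨1 / 2, by norm_num, by norm_num⟩ with ht
  have ht' : t ∈ Set.Ioo (0 : unitInterval) 1 :=
    ⟨Subtype.coe_lt_coe.1 (by norm_num [ht]), Subtype.coe_lt_coe.1 (by norm_num [ht])⟩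
  obtain ⟨g, hg⟩ := exists_potential_of_function (φ := φ) hfc (b := φ.edge e₂ t)
    (fun x _ => hf0 x) hf
  have hg' : ∀ e', e' ≠ e₂ → g (H.head e') - g (H.tail e') = if e' = e then 1 else 0 := by
    intro e' he'
    rw [← hg e' fun ⟨s, hs⟩ => he' (eq_of_edge_interior_eq ht' hs.symm)]
    split_ifs <;> simp
  refine hconn.false_of_potential (F := {e₂}) (by simp) (e := e) (g := g)
    (by rw [hg' e he₂.symm, if_pos rfl]) fun e' he' => ?_
  rw [hg' e' (by simpa using he')]
  split_ifs
  · exact ⟨1, by simp⟩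
  · exact ⟨0, by simp⟩

theorem finite_isFace [SphereLike S] [Finite V] [Finite E]
    (D : ∀ i : {F // φ.IsFace F}, φ.FaceDisc i.1) : Finite {F // φ.IsFace F} := by
  classical
  by_contra hfin
  have : Infinite {F // φ.IsFace F} := not_finite_iff_infinite.1 hfin
  obtain ⟨e, he⟩ := Finite.exists_infinite_fiber
    fun i => (D i).walk.get ⟨0, (D i).length_pos⟩
  let a := Infinite.natEmbedding
    ((fun i => (D i).walk.get ⟨0, (D i).length_pos⟩) ⁻¹' {e})
  have ha : ∀ n, e ∈ (D (a n).1).walk := fun n => by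
    have h : (D (a n).1).walk.get ⟨0, _⟩ = e := (a n).2
    exact (congrArg (· ∈ (D (a n).1).walk) h).mp (List.get_mem _ _)
  have hne : ∀ m n, m ≠ n → ((a m).1.1 : Set S) ≠ (a n).1.1 := fun m n hmn h =>
    hmn (a.injective (Subtype.ext (Subtype.ext h)))
  exact ((D (a 0).1).count_eq_one_and_notMem (D (a 1).1) (a 0).1.2 (a 1).1.2
    (hne 0 1 (by simp)) (ha 0) (ha 1)).2 _ (D (a 2).1) (a 2).1.2 (hne 2 0 (by simp))
    (hne 2 1 (by simp)) (ha 2)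

/-- Faces can be reached from each other through edges: the sphere without the finitely many vertex
points is connected. -/
theorem eq_univ_of_closed [SphereLike S] [Finite V] [Finite E] [Finite {F // φ.IsFace F}]
    (hreg : H.IsTwoRegular) (D : ∀ i : {F // φ.IsFace F}, φ.FaceDisc i.1)
    (hcov : ∀ e, ∃ i, e ∈ (D i).walk) (A : Set {F // φ.IsFace F}) (hA : A.Nonempty)
    (hcl : ∀ i j e, e ∈ (D i).walk → e ∈ (D j).walk → i ∈ A → j ∈ A) : A = Set.univ := by
  by_contra hne
  obtain ⟨j, hj⟩ := (Set.ne_univ_iff_exists_notMem A).1 hne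
  obtain ⟨i, hi⟩ := hA
  let U : Set {F // φ.IsFace F} → Set S := fun B => ⋃ k ∈ B, (D k).map '' Metric.closedBall 0 1
  have hU : ∀ B, IsClosed (U B) := fun B =>
    B.toFinite.isClosed_biUnion fun k _ => (D k).isClosed_image
  have hmem : ∀ k, (D k).map 0 ∈ (k.1 : Set S) := fun k => (D k).map_mem (by simp)
  have hvert : ∀ k, (D k).map 0 ∈ (Set.range φ.vert)ᶜ := by
    rintro k ⟨v, hv⟩
    exact k.2.notMem_carrier (hmem k) (hv ▸ vert_mem_carrier v)
  have hUmem : ∀ (B : Set {F // φ.IsFace F}) k, k ∈ B → (D k).map 0 ∈ U B := fun B k hk =>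
    Set.mem_biUnion hk ⟨0, by simp, rfl⟩
  obtain ⟨e₀, -⟩ := List.exists_mem_of_length_pos (D i).length_pos
  have hconn := isPreconnected_compl_finite (Set.finite_range φ.vert)
    ⟨_, H.tail e₀, rfl⟩
  obtain ⟨x, hxv, hxA, hxB⟩ := isPreconnected_closed_iff.1 hconn (U A) (U Aᶜ) (hU _) (hU _)
    (fun x _ => by
      have hx : ∃ k, x ∈ (D k).map '' Metric.closedBall 0 1 := by
        by_cases hx : x ∈ φ.carrier
        · rw [carrier_eq_iUnion hreg.exists_tail_eq] at hx
          obtain ⟨e, t, rfl⟩ := Set.mem_iUnion.1 hx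
          obtain ⟨k, hk⟩ := hcov e
          obtain ⟨z, hz, h⟩ := (D k).exists_edge_eq_map hk t
          exact ⟨k, z, by simp [hz], h⟩
        · obtain ⟨F, hF, hxF⟩ := exists_isFace_of_notMem hx
          exact ⟨⟨F, hF⟩, (D ⟨F, hF⟩).subset_image hxF⟩
      obtain ⟨k, hk⟩ := hx
      by_cases h : k ∈ A
      · exact Or.inl (Set.mem_biUnion h hk)
      · exact Or.inr (Set.mem_biUnion (show k ∈ Aᶜ from h) hk))
    ⟨_, hvert i, hUmem A i hi⟩ ⟨_, hvert j, hUmem Aᶜ j hj⟩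
  obtain ⟨k, hk, z, hz, rfl⟩ := Set.mem_iUnion₂.1 hxA
  obtain ⟨l, hl, z', hz', hzz⟩ := Set.mem_iUnion₂.1 hxB
  have hkl : k ≠ l := fun h => hl (h ▸ hk)
  rw [mem_closedBall_zero_iff] at hz hz'
  rcases hz.lt_or_eq with h1 | h1
  · rcases hz'.lt_or_eq with h2 | h2
    · exact hkl (Subtype.ext (k.2.eq_of_mem l.2 ((D k).map_mem h1) (hzz ▸ (D l).map_mem h2)))
    · exact k.2.notMem_carrier ((D k).map_mem h1) (hzz ▸ (D l).map_mem_carrier h2)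
  · obtain ⟨e, he, t, ht⟩ := (D k).exists_map_eq_edge h1
    rcases hz'.lt_or_eq with h2 | h2
    · exact l.2.notMem_carrier ((D l).map_mem h2) (hzz ▸ (D k).map_mem_carrier h1)
    · obtain ⟨e', he', t', ht'⟩ := (D l).exists_map_eq_edge h2
      have htI : t ∈ Set.Ioo (0 : unitInterval) 1 := by
        rcases eq_zero_or_one_or_mem_Ioo t with rfl | rfl | h
        · exact absurd ⟨_, (ht.trans (φ.edge e).source).symm⟩ hxv
        · exact absurd ⟨_, (ht.trans (φ.edge e).target).symm⟩ hxv
        · exact h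
      have : e' = e := eq_of_edge_interior_eq htI (ht.symm.trans (hzz.symm.trans ht'))
      exact hl (hcl k l e he (this ▸ he') hk)

/-- The boundary walks of the faces of an embedding in the sphere form a face system. -/
theorem isFaceSystem [SphereLike S] [Nonempty S] [Finite V] [Finite E] (hreg : H.IsTwoRegular)
    (hconn : H.IsStronglyEdgeConnected 2) (D : ∀ i : {F // φ.IsFace F}, φ.FaceDisc i.1) :
    H.IsFaceSystem fun i => (D i).walk := by
  classical
  have hfin := finite_isFace D
  have hpot : ∀ i₁ (c : E → ℤ), (∀ i, i ≠ i₁ → ((D i).walk.map c).sum = 0) →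
      ∃ g : V → ℂ, ∀ e, (c e : ℂ) = g (H.head e) - g (H.tail e) :=
    fun i₁ c hc => exists_potential hreg.exists_tail_eq D i₁ hc
  -- If only one face passed `e`, the indicator function of `e` would be a difference of potentials.
  have hother : ∀ e i, ∃ j, j ≠ i ∧ e ∈ (D j).walk := by
    intro e i
    by_contra! hno
    obtain ⟨g, hg⟩ := hpot i (fun e' => if e' = e then 1 else 0) fun j hj =>
      List.sum_eq_zero fun n hn => by
        obtain ⟨e', he', rfl⟩ := List.mem_map.1 hn
        have hne : e' ≠ e := fun h => hno j hj (h ▸ he')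
        simp [hne]
    refine hconn.false_of_potential (F := ∅) (by simp) (e := e) (g := g)
      (by rw [← hg, if_pos rfl, Int.cast_one]) fun e' _ => ?_
    rw [← hg]
    split_ifs
    · exact ⟨1, by simp⟩
    · exact ⟨0, by simp⟩
  have hcov : ∀ e, ∃ i, e ∈ (D i).walk := fun e => by
    obtain ⟨F, hF⟩ := exists_isFace hreg hconn φ
    obtain ⟨j, -, hj⟩ := hother e ⟨F, hF⟩
    exact ⟨j, hj⟩
  have hne : ∀ {i j : {F // φ.IsFace F}}, i ≠ j → i.1 ≠ j.1 := fun h h' => h (Subtype.ext h')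
  refine ⟨fun i => (D i).isClosedDiwalk, fun i => ?_, fun e => ?_, hpot,
    fun A hA hcl => eq_univ_of_closed hreg D hcov A hA hcl⟩
  · rw [List.nodup_iff_count_le_one]
    intro e
    by_cases he : e ∈ (D i).walk
    · obtain ⟨j, hji, hj⟩ := hother e i
      exact ((D j).count_eq_one_and_notMem (D i) j.2 i.2 (hne hji) hj he).1.le
    · rw [List.count_eq_zero.2 he]
      exact zero_le_one
  · obtain ⟨i, hi⟩ := hcov e
    obtain ⟨j, hji, hj⟩ := hother e i
    refine ⟨i, j, hji.symm, hi, hj, fun k hk => ?_⟩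
    by_contra! h
    exact ((D i).count_eq_one_and_notMem (D j) i.2 j.2 (hne hji.symm) hi hj).2 _ (D k) k.2
      (hne h.1) (hne h.2) hk

end GraphEmbedding

end MultiDigraph

/-! ### Colouring the faces -/

/-- A list without repetitions that is traced by the function `f` is the orbit of `f`. -/
theorem List.Nodup.coe_eq_periodicOrbit {α : Type*} {l : List α} (hl : l.Nodup) {f : α → α}
    (hf : ∀ (j : ℕ) (hj : j < l.length),
      f l[j] = l[(j + 1) % l.length]'(Nat.mod_lt _ (by omega))) {x : α} (hx : x ∈ l) :
    (l : Cycle α) = Function.periodicOrbit f x := by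
  obtain ⟨i, hi, rfl⟩ := List.mem_iff_getElem.1 hx
  have hpos : 0 < l.length := by omega
  have hit : ∀ k, f^[k] l[i] = l[(k + i) % l.length]'(Nat.mod_lt _ hpos) := by
    intro k
    induction k with
    | zero => simp [Nat.mod_eq_of_lt hi]
    | succ k ih =>
      rw [Function.iterate_succ_apply', ih, hf]
      congr 1
      rw [Nat.mod_add_mod]
      congr 1
      omega
  have hper : Function.IsPeriodicPt f l.length l[i] := by
    rw [Function.IsPeriodicPt, Function.IsFixedPt, hit]
    simp [Nat.mod_eq_of_lt hi]
  have hmin : Function.minimalPeriod f l[i] = l.length := by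
    refine le_antisymm (hper.minimalPeriod_le hpos) ?_
    have h1 := hper.minimalPeriod_pos hpos
    have h2 : f^[Function.minimalPeriod f l[i]] l[i] = l[i] :=
      Function.iterate_minimalPeriod
    rw [hit, hl.getElem_inj_iff] at h2
    by_contra h
    push Not at h
    rcases lt_or_ge (Function.minimalPeriod f l[i] + i) l.length with h3 | h3
    · rw [Nat.mod_eq_of_lt h3] at h2
      omega
    · rw [Nat.mod_eq_sub_mod h3, Nat.mod_eq_of_lt (by omega)] at h2
      omega
  rw [Function.periodicOrbit_def, hmin, Cycle.coe_eq_coe]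
  refine ⟨i, List.ext_getElem (by simp) fun k hk hk' => ?_⟩
  rw [List.getElem_rotate, List.getElem_map, List.getElem_range, hit]

namespace MultiDigraph

variable {V E ι : Type*} {H : MultiDigraph V E} {walk : ι → List E}

theorem sum_map_indicator [DecidableEq E] {l : List E} (hl : l.Nodup) (e : E) :
    (l.map fun e' => if e' = e then (1 : ℤ) else 0).sum = if e ∈ l then 1 else 0 := by
  rw [List.sum_map_ite_eq]
  by_cases h : e ∈ l
  · simp [h, List.count_eq_one_of_mem hl h]
  · simp [h, List.count_eq_zero.2 h]

namespace IsFaceSystem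

/-- Two faces with a common edge are adjacent. -/
def adjacency (walk : ι → List E) : SimpleGraph ι where
  Adj i j := i ≠ j ∧ ∃ e, e ∈ walk i ∧ e ∈ walk j
  symm := ⟨fun _ _ ⟨h, e, hi, hj⟩ => ⟨h.symm, e, hj, hi⟩⟩
  loopless := ⟨fun _ h => h.1 rfl⟩

/-- The alternating sum of the edges crossed by a walk of faces has a nonzero sum only along the
first and the last face. -/
theorem exists_alternating [DecidableEq ι] (h : H.IsFaceSystem walk) {u v : ι}
    (p : (adjacency walk).Walk u v) : ∃ c : E → ℤ, ∀ i, ((walk i).map c).sum =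
      (if i = u then 1 else 0) - (-1) ^ p.length * (if i = v then 1 else 0) := by
  classical
  induction p with
  | nil => exact ⟨fun _ => 0, fun i => by simp⟩
  | @cons u u' v hadj p ih =>
    obtain ⟨c, hc⟩ := ih
    obtain ⟨hne, e, hu, hu'⟩ := id hadj
    refine ⟨fun e' => (if e' = e then 1 else 0) + -1 * c e', fun i => ?_⟩
    have hmem : e ∈ walk i ↔ i = u ∨ i = u' := by
      obtain ⟨a, b, hab, ha, hb, hk⟩ := h.exists_two e
      constructor
      · intro hi
        have h1 := hk i hi
        have h2 := hk u hu
        have h3 := hk u' hu'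
        grind
      · rintro (rfl | rfl) <;> assumption
    rw [List.sum_map_add, List.sum_map_mul_left, hc, sum_map_indicator (h.nodup i), SimpleGraph.Walk.length_cons, pow_succ]
    generalize (if i = v then (1 : ℤ) else 0) = t
    by_cases h1 : i = u
    · subst h1
      simp [hmem, hne]
    · simp [hmem, h1]

/-- The faces have a colouring with two colours such that the two faces at an edge have different
colours: the alternating sum of the edges crossed by an odd closed walk of faces would have a
nonzero sum along a single face. -/
theorem exists_colouring (h : H.IsFaceSystem walk) : ∃ col : ι → Bool,
    ∀ i j e, e ∈ walk i → e ∈ walk j → col i = col j → i = j := by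
  classical
  have hcol : (adjacency walk).Colorable 2 := by
    rw [SimpleGraph.two_colorable_iff_forall_loop_even]
    intro u p
    by_contra hodd
    rw [Nat.not_even_iff_odd] at hodd
    obtain ⟨c, hc⟩ := h.exists_alternating p
    obtain ⟨g, hg⟩ := h.exists_potential u c fun i hi => by simp [hc, hi]
    have h1 := hc u
    have h2 := (h.isClosedDiwalk u).sum_sub_eq_zero g
    simp_rw [← hg] at h2
    have h3 : ((((walk u).map c).sum : ℤ) : ℂ) = 0 := by
      rw [Int.cast_list_sum, List.map_map]
      exact h2
    rw [Int.cast_eq_zero.1 h3, hodd.neg_one_pow] at h1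
    simp at h1
  obtain ⟨col⟩ := hcol
  refine ⟨fun i => col i = 0, fun i j e hi hj hij => ?_⟩
  by_contra hne
  have hval := col.valid (show (adjacency walk).Adj i j from ⟨hne, e, hi, hj⟩)
  simp only [decide_eq_decide] at hij
  omega

end IsFaceSystem

/-- The faces on the two sides of the edges and the way in which they are traced. The faces come in
two colours; for either colour `b`, the edge `e` is passed by exactly one face `face b e` of colour
`b`, and `next b e` is the edge that follows `e` on the boundary of this face. -/
structure Tracing (H : MultiDigraph V E) (ι : Type*) where
  /-- The edge following a given edge on its face of a given colour. -/
  next : Bool → E → E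
  /-- The face of a given colour at a given edge. -/
  face : Bool → E → ι
  tail_next : ∀ b e, H.tail (next b e) = H.head e
  face_next : ∀ b e, face b (next b e) = face b e
  next_injective : ∀ b, Function.Injective (next b)
  exists_potential : ∀ [Fintype E] [DecidableEq ι] (c : E → ℤ),
    (∀ b i, ∑ e with face b e = i, c e = 0) →
      ∃ g : V → ℂ, ∀ e, (c e : ℂ) = g (H.head e) - g (H.tail e)

/-- The tracing of a face system. -/
theorem IsFaceSystem.exists_tracing [Nonempty ι] (h : H.IsFaceSystem walk) :
    ∃ T : H.Tracing ι, (∀ b e, e ∈ walk (T.face b e)) ∧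
      (∀ i, ∃ b, ∀ e ∈ walk i, T.face b e = i) ∧
      ∀ b e, (walk (T.face b e) : Cycle E) = Function.periodicOrbit (T.next b) e := by
  classical
  obtain ⟨col, hcol⟩ := h.exists_colouring
  have hface : ∀ b e, ∃ i, col i = b ∧ e ∈ walk i := fun b e => by
    obtain ⟨i, j, hij, hi, hj, -⟩ := h.exists_two e
    have hne : col i ≠ col j := fun hc => hij (hcol i j e hi hj hc)
    by_cases hb : col i = b
    · exact ⟨i, hb, hi⟩
    · exact ⟨j, by revert hne hb; cases col i <;> cases col j <;> cases b <;> simp, hj⟩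
  choose face hface hmem using hface
  have hface_eq : ∀ {b e i}, col i = b → e ∈ walk i → face b e = i := fun hb he =>
    hcol _ _ _ (hmem _ _) he ((hface _ _).trans hb.symm)
  let next : Bool → E → E := fun b e => (walk (face b e)).next e (hmem b e)
  have hnext_mem : ∀ b e, next b e ∈ walk (face b e) := fun b e => List.next_mem _ _ _
  have hface_next : ∀ b e, face b (next b e) = face b e := fun b e =>
    hface_eq (hface b e) (hnext_mem b e)
  have hget : ∀ b i, col i = b → ∀ (j : ℕ) (hj : j < (walk i).length), next b (walk i)[j] =
      (walk i)[(j + 1) % (walk i).length]'(Nat.mod_lt _ (by omega)) := by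
    intro b i hi j hj
    have hf := hface_eq hi (List.getElem_mem hj)
    have key : ∀ i' (hm : (walk i)[j] ∈ walk i'), i' = i → (walk i').next (walk i)[j] hm =
        (walk i)[(j + 1) % (walk i).length]'(Nat.mod_lt _ (by omega)) := by
      rintro _ hm rfl
      exact List.next_getElem _ (h.nodup _) _ _
    exact key _ _ hf
  refine ⟨⟨next, face, fun b e => ?_, hface_next, fun b e e' hee => ?_, fun c hc => ?_⟩, hmem,
    fun i => ⟨col i, fun e he => hface_eq rfl he⟩, fun b e => ?_⟩
  · obtain ⟨j, hj, hje⟩ := List.mem_iff_getElem.1 (hmem b e)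
    obtain ⟨hpos, hw⟩ := h.isClosedDiwalk (face b e)
    have h1 := hget b _ (hface b e) j hj
    rw [hje] at h1
    rw [h1]
    have h2 := hw ⟨j, hj⟩
    simp only [List.get_eq_getElem, hje] at h2
    exact h2.symm
  · have hf : face b e = face b e' := by rw [← hface_next, hee, hface_next]
    have key : ∀ i (he : e ∈ walk i) (he' : e' ∈ walk i), (walk i).next e he =
        (walk i).next e' he' → e = e' := fun i he he' hn => by
      rw [← List.prev_next _ (h.nodup i) e he, ← List.prev_next _ (h.nodup i) e' he']
      congr 1
    refine key (face b e) (hmem b e) (hf ▸ hmem b e') (hee.trans ?_)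
    simp only [next]
    congr 1
    exact congrArg walk hf.symm
  · obtain ⟨i₁⟩ := ‹Nonempty ι›
    refine h.exists_potential i₁ c fun i _ => ?_
    rw [← List.sum_toFinset _ (h.nodup i), ← hc (col i) i]
    refine Finset.sum_congr (Finset.ext fun e => ?_) fun _ _ => rfl
    simp only [List.mem_toFinset, Finset.mem_filter, Finset.mem_univ, true_and]
    exact ⟨hface_eq rfl, fun he => he ▸ hmem _ e⟩
  · exact (h.nodup _).coe_eq_periodicOrbit (hget b _ (hface b e)) (hmem b e)

namespace Tracing

/-! ### Uniqueness of the tracing -/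

variable (T : H.Tracing ι)

theorem sum_next [Fintype E] [DecidableEq ι] {A : Type*} [AddCommMonoid A] (b : Bool) (i : ι)
    (f : E → A) : ∑ e with T.face b e = i, f (T.next b e) = ∑ e with T.face b e = i, f e :=
  Finset.sum_equiv (Equiv.ofBijective _ (Finite.injective_iff_bijective.1 (T.next_injective b)))
    (fun e => by simp [T.face_next]) fun e _ => rfl

/-- Two faces of different colours have at most one common edge. The difference of the indicator
functions of two common edges would be a difference of potentials, whose level sets give a directed
cut with a single edge. -/
theorem eq_of_face_eq [Finite E] (hconn : H.IsStronglyEdgeConnected 2) {e e' : E}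
    (h : ∀ b, T.face b e = T.face b e') : e = e' := by
  classical
  by_contra hne
  have := Fintype.ofFinite E
  obtain ⟨g, hg⟩ := T.exists_potential
    (fun a => (if a = e then 1 else 0) - if a = e' then 1 else 0) fun b i => by
      rw [Finset.sum_sub_distrib, Finset.sum_ite_eq', Finset.sum_ite_eq']
      simp [h b]
  refine hconn.false_of_potential (F := {e'}) (by simp) (e := e) (g := g)
    (by rw [← hg]; simp [hne]) fun a ha => ?_
  rw [← hg]
  have ha' : a ≠ e' := by simpa using ha
  by_cases hae : a = e
  · exact ⟨1, by simp [hae, hne]⟩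
  · exact ⟨0, by simp [hae, ha']⟩

/-- The faces of the two colours at an edge proceed to different edges. Otherwise the edge and its
successor are shared by the two faces, so they coincide and form a loop that bounds both faces; as
faces are connected through edges, there are no other faces, and hence no other edges. -/
theorem next_true_ne_next_false [Finite E] (hreg : H.IsTwoRegular)
    (hconn : H.IsStronglyEdgeConnected 2) (h : H.IsFaceSystem walk)
    (hmem : ∀ b e, e ∈ walk (T.face b e)) (hcol : ∀ i, ∃ b, ∀ e ∈ walk i, T.face b e = i)
    (horb : ∀ b e, (walk (T.face b e) : Cycle E) = Function.periodicOrbit (T.next b) e) (e : E) :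
    T.next true e ≠ T.next false e := by
  intro heq
  have hloop : ∀ b, T.next b e = e := by
    have h1 : T.next true e = e := T.eq_of_face_eq hconn fun b => by
      cases b
      · rw [heq, T.face_next]
      · rw [T.face_next]
    intro b
    cases b
    · rw [← heq, h1]
    · exact h1
  have honly : ∀ b f, f ∈ walk (T.face b e) → f = e := by
    intro b f hf
    have h1 : f ∈ (walk (T.face b e) : Cycle E) := Cycle.mem_coe_iff.2 hf
    have hper : e ∈ Function.periodicPts (T.next b) :=
      Function.mk_mem_periodicPts one_pos (hloop b)
    rw [horb, Function.mem_periodicOrbit_iff hper] at h1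
    obtain ⟨n, rfl⟩ := h1
    exact Function.iterate_fixed (hloop b) n
  have hwalk : ∀ i, e ∈ walk i → ∀ f ∈ walk i, f = e := by
    intro i hi f hf
    obtain ⟨b, hb⟩ := hcol i
    exact honly b f ((hb e hi).symm ▸ hf)
  have huniv := h.eq_univ_of_closed {i | e ∈ walk i} ⟨_, hmem true e⟩ fun i j f hi hj hiA =>
    hwalk i hiA f hi ▸ hj
  obtain ⟨e', hne, -⟩ := hreg.exists_ne_tail_eq e
  have hA : T.face true e' ∈ {i | e ∈ walk i} := huniv ▸ Set.mem_univ _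
  exact hne (hwalk _ hA e' (hmem true e'))

theorem eq_next_or_eq_next (hreg : H.IsTwoRegular) {T : H.Tracing ι}
    (hT : ∀ e, T.next true e ≠ T.next false e) {e f : E} (hf : H.tail f = H.head e) :
    f = T.next true e ∨ f = T.next false e := by
  obtain ⟨a, b, hab, h⟩ := Set.ncard_eq_two.1 (hreg (H.head e)).1
  have hout : ∀ f, H.tail f = H.head e → f = a ∨ f = b := fun f hf => by
    have : f ∈ {f : E | H.tail f = H.head e} := hf
    rw [h] at this
    exact this
  have h1 := hout f hf
  have h2 := hout _ (T.tail_next true e)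
  have h3 := hout _ (T.tail_next false e)
  have h4 := hT e
  grind

/-- Any two tracings agree up to an exchange of the colours. Let `X` be the set of vertices at which
they agree as coloured tracings. For a face `i` of the first tracing, the edges of `i` entering or
leaving `X`, counted with signs, add up to zero along every face of the second tracing, so they are
given by a difference of potentials, and add up to zero along every closed walk. But a face of
the first tracing of the other colour has at most one edge in common with `i`. So no edge enters or
leaves `X`. -/
theorem next_eq_or_eq_swap [Finite E] {ι' : Type*} (hreg : H.IsTwoRegular)
    (hconn : H.IsStronglyEdgeConnected 2) {T : H.Tracing ι} {T' : H.Tracing ι'}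
    (hT : ∀ e, T.next true e ≠ T.next false e) (hT' : ∀ e, T'.next true e ≠ T'.next false e) :
    (∀ b e, T'.next b e = T.next b e) ∨ ∀ b e, T'.next b e = T.next (!b) e := by
  classical
  have := Fintype.ofFinite E
  let X : Set V := {v | ∀ e, H.head e = v → T'.next true e = T.next true e}
  have hin : ∀ e, H.head e ∈ X → ∀ b, T'.next b e = T.next b e := by
    intro e he
    have h1 : T'.next true e = T.next true e := he e rfl
    have h2 := eq_next_or_eq_next hreg hT (T'.tail_next false e)
    have h3 := hT' e
    intro b
    cases b
    · grind
    · exact h1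
  have hout : ∀ e, H.head e ∉ X → ∀ b, T'.next b e = T.next (!b) e := by
    intro e he
    have h1 : T'.next true e = T.next false e := by
      obtain ⟨e₁, he₁, hne⟩ : ∃ e₁, H.head e₁ = H.head e ∧
          T'.next true e₁ ≠ T.next true e₁ := by
        simpa [X] using he
      have h2 := (eq_next_or_eq_next hreg hT (T'.tail_next true e₁)).resolve_left hne
      refine (eq_next_or_eq_next hreg hT (T'.tail_next true e)).resolve_left fun h3 => ?_
      have h4 := eq_next_or_eq_next hreg hT (e := e₁) ((T.tail_next true e).trans he₁.symm)
      rcases h4 with h4 | h4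
      · have := T.next_injective true h4
        subst this
        exact hne h3
      · have := T'.next_injective true (h3.trans (h4.trans h2.symm))
        subst this
        exact hne h3
    have h2 := eq_next_or_eq_next hreg hT (T'.tail_next false e)
    have h3 := hT' e
    intro b
    cases b
    · simp only [Bool.not_false]
      grind
    · exact h1
  let x : V → ℤ := fun v => if v ∈ X then 1 else 0
  have hcross : ∀ e₀, x (H.tail e₀) = x (H.head e₀) := by
    intro e₀
    let y : E → ℤ := fun e => if T.face false e = T.face false e₀ then 1 else 0
    have hy : ∀ e, y (T.next false e) = y e := fun e => by simp only [y, T.face_next]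
    obtain ⟨g, hg⟩ := T'.exists_potential
      (fun e => y e * (x (H.tail e) - x (H.head e))) fun b j => by
        have h1 : ∑ e with T'.face b e = j, y e * (x (H.tail e) - x (H.head e)) =
            ∑ e with T'.face b e = j, (y (T'.next b e) - y e) * x (H.head e) := by
          simp_rw [mul_sub, sub_mul, Finset.sum_sub_distrib]
          rw [← T'.sum_next b j fun e => y e * x (H.tail e)]
          simp_rw [T'.tail_next]
        rw [h1]
        -- a face of colour `false` follows the first tracing's faces of that colour inside `X`, a
        -- face of colour `true` follows them outside `X`
        cases b
        · refine Finset.sum_eq_zero fun e _ => ?_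
          by_cases he : H.head e ∈ X
          · rw [hin e he, hy, sub_self, zero_mul]
          · simp [x, he]
        · have h2 : ∀ e, (y (T'.next true e) - y e) * x (H.head e) =
              y (T'.next true e) - y e := fun e => by
            by_cases he : H.head e ∈ X
            · simp [x, he]
            · rw [hout e he, Bool.not_true, hy, sub_self, zero_mul]
          simp_rw [h2, Finset.sum_sub_distrib, T'.sum_next, sub_self]
    have h0 : ∑ e with T.face true e = T.face true e₀,
        ((y e * (x (H.tail e) - x (H.head e)) : ℤ) : ℂ) = 0 := by
      simp_rw [hg, Finset.sum_sub_distrib, ← T.tail_next true]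
      rw [T.sum_next true _ fun e => g (H.tail e), sub_self]
    -- only `e₀` is common to the face and the face of the other colour
    rw [Finset.sum_eq_single_of_mem e₀ (by simp) fun e he hne => ?_] at h0
    · simp only [y, if_pos, one_mul, Int.cast_eq_zero] at h0
      exact sub_eq_zero.1 h0
    · have hf : T.face false e ≠ T.face false e₀ := fun hf => hne <|
        T.eq_of_face_eq hconn fun b => by
          cases b
          · exact hf
          · simpa using he
      simp [y, hf]
  have hconst : ∀ u v, u ∈ X → v ∈ X := by
    intro u v hu
    have h := hconn ∅ (by simp) u v
    induction h with
    | refl => exact hu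
    | tail _ h ih =>
      obtain ⟨e, -, rfl, rfl⟩ := h
      have := hcross e
      by_contra hv
      simp [x, ih, hv] at this
  by_cases hX : ∃ u, u ∈ X
  · obtain ⟨u, hu⟩ := hX
    exact Or.inl fun b e => hin e (hconst u _ hu) b
  · exact Or.inr fun b e => hout e (fun h => hX ⟨_, h⟩) b

end Tracing

/-! ### Comparing two embeddings -/

theorem GraphEmbedding.FaceDisc.boundedBy {S : Type*} [TopologicalSpace S]
    {φ : H.GraphEmbedding S} {F : Set S} (D : φ.FaceDisc F) : φ.BoundedBy F D.walk := by
  refine ⟨D.isClosedDiwalk, D.map, D.continuousOn, D.isEmbedding, D.image_ball, fun j t => ?_⟩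
  rw [← D.map_turn j t, turn]
  push_cast
  rfl

theorem Embedding.facialWalks_subset {S : Type*} [TopologicalSpace S] [SphereLike S] [Nonempty S]
    [Finite V] [Finite E] (hreg : H.IsTwoRegular) (hconn : H.IsStronglyEdgeConnected 2)
    (φ₁ φ₂ : H.Embedding S) : φ₁.facialWalks ⊆ φ₂.facialWalks := by
  classical
  rintro _ ⟨F, w, hF, hw, rfl⟩
  have hD : ∀ φ : H.Embedding S, ∀ i : {F // φ.IsFace F},
      Nonempty (φ.toGraphEmbedding.FaceDisc i.1) := fun φ i => by
    obtain ⟨w, hw⟩ := φ.face_bounded i.1 i.2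
    exact ⟨hw.exists_faceDisc.choose⟩
  -- the family of discs of the first embedding is chosen to contain the given disc
  obtain ⟨D, rfl⟩ := hw.exists_faceDisc
  let D₁ : ∀ i : {F // φ₁.IsFace F}, φ₁.toGraphEmbedding.FaceDisc i.1 :=
    Function.update (fun i => (hD φ₁ i).some) ⟨F, hF⟩ D
  have hD₁ : D₁ ⟨F, hF⟩ = D := Function.update_self ..
  let D₂ : ∀ i : {F // φ₂.IsFace F}, φ₂.toGraphEmbedding.FaceDisc i.1 := fun i => (hD φ₂ i).some
  have h₁ := GraphEmbedding.isFaceSystem hreg hconn D₁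
  have h₂ := GraphEmbedding.isFaceSystem hreg hconn D₂
  have : Nonempty {F // φ₁.IsFace F} := ⟨⟨F, hF⟩⟩
  have : Nonempty {F // φ₂.IsFace F} := by
    obtain ⟨F', hF'⟩ := GraphEmbedding.exists_isFace hreg hconn φ₂.toGraphEmbedding
    exact ⟨⟨F', hF'⟩⟩
  obtain ⟨T₁, hmem₁, hcol₁, horb₁⟩ := h₁.exists_tracing
  obtain ⟨T₂, hmem₂, hcol₂, horb₂⟩ := h₂.exists_tracing
  obtain ⟨b, hb⟩ := hcol₁ ⟨F, hF⟩
  obtain ⟨e, he⟩ := List.exists_mem_of_length_pos (D₁ ⟨F, hF⟩).length_pos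
  have hwalk : (D.walk : Cycle E) = Function.periodicOrbit (T₁.next b) e := by
    rw [← horb₁ b e, hb e he, hD₁]
  obtain ⟨b', hb'⟩ : ∃ b', T₂.next b' = T₁.next b := by
    rcases Tracing.next_eq_or_eq_swap hreg hconn
      (T₁.next_true_ne_next_false hreg hconn h₁ hmem₁ hcol₁ horb₁)
      (T₂.next_true_ne_next_false hreg hconn h₂ hmem₂ hcol₂ horb₂) with h | h
    · exact ⟨b, funext (h b)⟩
    · exact ⟨!b, funext fun e => by rw [h, Bool.not_not]⟩
  refine ⟨_, _, (T₂.face b' e).2, (D₂ _).boundedBy, ?_⟩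
  rw [horb₂, hb', hwalk]

end MultiDigraph

theorem mainTheorem3 {V : Type*} {E : Type*} [Finite V] [Finite E]
    (H : MultiDigraph V E) (hreg : H.IsTwoRegular) (hconn : H.IsStronglyEdgeConnected 2)
    (φ₁ φ₂ : H.Embedding (Metric.sphere (0 : EuclideanSpace ℝ (Fin 3)) 1)) :
    φ₁.Equivalent φ₂ := by
  have : Nonempty (Metric.sphere (0 : EuclideanSpace ℝ (Fin 3)) 1) :=
    (NormedSpace.sphere_nonempty.2 zero_le_one).to_subtype
  exact Set.Subset.antisymm (MultiDigraph.Embedding.facialWalks_subset hreg hconn φ₁ φ₂)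
    (MultiDigraph.Embedding.facialWalks_subset hreg hconn φ₂ φ₁)
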